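/- Let $\mathcal E$ be a locally small category with pullbacks and $T=(T,m,i)$ an arbitrary monad on $\mathcal E$ (not assumed cartesian). A $T$-simplicial object $X$ consists of objects $X_n$ of $\mathcal E$ ($n\ge 0$), face maps $d_i\colon X_n\to X_{n-1}$ for $0\le i<n$ and $d_n\colon X_n\to TX_{n-1}$ ($n>0$), and degeneracy maps $s_i\colon X_n\to X_{n+1}$ for $0\le i\le n$, satisfying the simplicial identities with the maps $d_n\colon X_n\to TX_{n-1}$ regarded as morphisms $X_n\to X_{n-1}$ of the Kleisli category of $T$; those identities that involve no last face hold in $\mathcal E$. $T$-simplicial objects form a category $s_T\mathcal E$, enriched over simplicial sets as follows: an $n$-simplex of the hom $\underline{s_T\mathcal E}(X,Y)$ is a family of morphisms $x_\phi\colon X_m\to Y_m$ of $\mathcal E$, indexed by the monotone maps $\phi\colon[m]\to[n]$ ($m\ge 0$), with $d_ix_\phi=x_{\phi\delta_i}d_i$ for $0\le i<m$, $d_mx_\phi=T(x_{\phi\delta_m})\,d_m$ for $m>0$, and $s_ix_\phi=x_{\phi\sigma_i}s_i$ for $0\le i\le m$; identities and composition are componentwise. A $T$-category is a $T$-simplicial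 object $X$ such that for every $n\ge 2$ the square $Td_0\circ d_n=d_{n-1}\circ d_0\colon X_n\to TX_{n-2}$ exhibits $X_n$ as the pullback of $d_{n-1}\colon X_{n-1}\to TX_{n-2}$ and $Td_0\colon TX_{n-1}\to TX_{n-2}$. Write $\underline{\mathbf{Cat}_T(\mathcal E)}$ for the full simplicially enriched subcategory of $\underline{s_T\mathcal E}$ on the $T$-categories. For a category $\mathcal C$ enriched in a symmetric monoidal closed category $\mathcal V$, a power of $X\in\mathcal C$ by $A\in\mathcal V$ is an object $L$ with a morphism $\kappa\colon A\to\mathcal C(L,X)$ such that the induced morphism $\mathcal C(Y,L)\to[A,\mathcal C(Y,X)]$ is an isomorphism in $\mathcal V$ for every $Y\in\mathcal C$. Then: 1. Every $T$-category $X$ has a power by the simplicial set $\Delta[1]$ in $\underline{s_T\mathcal E}$, and every power of $X$ by $\Delta[1]$ in $\underline{s_T\mathcal E}$ is again a $T$-category. 2. For every $T$-simplicial object $X$ and every $T$-category $Y$, the simplicial set $\underline{s_T\mathcal E}(X,Y)$ is the nerve of a category; so $\underline{\mathbf{Cat}_T(\mathcal E)}$ is a $2$-category, whose hom-categories are the categories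 having the hom simplicial sets as nerves. 3. The $2$-category $\underline{\mathbf{Cat}_T(\mathcal E)}$ has powers by the arrow category $\mathbf 2=\{0<1\}$: every $T$-category has a power by $\mathbf 2$, in the sense of categories enriched over the cartesian closed category of small categories. -/

import Mathlib

open CategoryTheory Limits MonoidalCategory Simplicial Opposite

universe w w' v u

section Powers

variable {V : Type w} [Category.{w'} V] [MonoidalCategory V] [BraidedCategory V]
  [MonoidalClosed V] {C : Type u} [EnrichedCategory V C]

/-- For a `V`-category `C`, an object `A` of `V` and a "cylinder" `κ : A ⟶ C(L, X)`, the induced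
comparison map `C(Y, L) ⟶ [A, C(Y, X)]` in `V`. It is the transpose of
`A ⊗ C(Y, L) ≅ C(Y, L) ⊗ A ⟶ C(Y, L) ⊗ C(L, X) ⟶ C(Y, X)`, and is `V`-natural in `Y`. -/
noncomputable def powerComparison (A : V) {X L : C} (κ : A ⟶ (L ⟶[V] X)) (Y : C) :
    (Y ⟶[V] L) ⟶ (ihom A).obj (Y ⟶[V] X) :=
  MonoidalClosed.curry ((β_ A (Y ⟶[V] L)).hom ≫ (Y ⟶[V] L) ◁ κ ≫ eComp V Y L X)

/-- `L`, with the universal cylinder `κ : A ⟶ C(L, X)`, is the power (cotensor) of `X` by `A` in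
the `V`-category `C`: the maps `C(Y, L) ⟶ [A, C(Y, X)]` are isomorphisms in `V` for all `Y`. -/
def IsPower (A : V) (X L : C) (κ : A ⟶ (L ⟶[V] X)) : Prop :=
  ∀ Y : C, IsIso (powerComparison A κ Y)

end Powers

/-- A `T`-simplicial object for a monad `T` on `E`: a simplicial object, except that the last face
map `d_{n+1}` on `X_{n+1}` takes values in `T X_n`.

Here `d n i : X_{n+1} ⟶ X_n` is the face `d_i` for `0 ≤ i ≤ n`, `dTop n : X_{n+1} ⟶ T X_n` is the
last face `d_{n+1}`, and `s n i : X_n ⟶ X_{n+1}` is the degeneracy `s_i` for `0 ≤ i ≤ n`. -/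
structure TSimplicialObject {E : Type u} [Category.{v} E] (T : Monad E) where
  /-- the object of `n`-simplices -/
  X : ℕ → E
  /-- the faces other than the last one -/
  d (n : ℕ) (i : Fin (n + 1)) : X (n + 1) ⟶ X n
  /-- the last face -/
  dTop (n : ℕ) : X (n + 1) ⟶ T.obj (X n)
  /-- the degeneracies -/
  s (n : ℕ) (i : Fin (n + 1)) : X n ⟶ X (n + 1)
  d_comp_d (n : ℕ) (i j : Fin (n + 1)) (hij : i ≤ j) :
    d (n + 1) i.castSucc ≫ d n j = d (n + 1) j.succ ≫ d n i
  d_comp_dTop (n : ℕ) (i : Fin (n + 1)) :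
    d (n + 1) i.castSucc ≫ dTop n = dTop (n + 1) ≫ T.map (d n i)
  d_last_comp_dTop (n : ℕ) :
    d (n + 1) (Fin.last (n + 1)) ≫ dTop n = dTop (n + 1) ≫ T.map (dTop n) ≫ T.μ.app (X n)
  s_comp_s (n : ℕ) (i j : Fin (n + 1)) (hij : i ≤ j) :
    s n i ≫ s (n + 1) j.succ = s n j ≫ s (n + 1) i.castSucc
  s_comp_d_of_lt (n : ℕ) (i j : Fin (n + 1)) (hij : i ≤ j) :
    s (n + 1) j.succ ≫ d (n + 1) i.castSucc = d n i ≫ s n j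
  s_comp_d_self (n : ℕ) (j : Fin (n + 1)) : s n j ≫ d n j = 𝟙 (X n)
  s_comp_d_succ (n : ℕ) (j : Fin n) : s n j.castSucc ≫ d n j.succ = 𝟙 (X n)
  s_last_comp_dTop (n : ℕ) : s n (Fin.last n) ≫ dTop n = T.η.app (X n)
  s_comp_d_of_gt (n : ℕ) (i j : Fin (n + 1)) (hij : j < i) :
    s (n + 1) j.castSucc ≫ d (n + 1) i.succ = d n i ≫ s n j
  s_comp_dTop (n : ℕ) (j : Fin (n + 1)) :
    s (n + 1) j.castSucc ≫ dTop (n + 1) = dTop n ≫ T.map (s n j)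

namespace TSimplicialObject

variable {E : Type u} [Category.{v} E] {T : Monad E}

/-- A morphism of `T`-simplicial objects. -/
@[ext]
structure Hom (X Y : TSimplicialObject T) where
  /-- the components -/
  f (n : ℕ) : X.X n ⟶ Y.X n
  d_comm (n : ℕ) (i : Fin (n + 1)) : f (n + 1) ≫ Y.d n i = X.d n i ≫ f n
  dTop_comm (n : ℕ) : f (n + 1) ≫ Y.dTop n = X.dTop n ≫ T.map (f n)
  s_comm (n : ℕ) (i : Fin (n + 1)) : f n ≫ Y.s n i = X.s n i ≫ f (n + 1)

/-- The category `s_T E` of `T`-simplicial objects. -/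
instance : Category (TSimplicialObject T) where
  Hom := Hom
  id X :=
    { f := fun n => 𝟙 (X.X n)
      d_comm := by simp
      dTop_comm := by simp
      s_comm := by simp }
  comp a b :=
    { f := fun n => a.f n ≫ b.f n
      d_comm := fun n i => by rw [Category.assoc, b.d_comm, ← Category.assoc, a.d_comm,
        Category.assoc]
      dTop_comm := fun n => by rw [Category.assoc, b.dTop_comm, ← Category.assoc, a.dTop_comm,
        Category.assoc, T.map_comp]
      s_comm := fun n i => by rw [Category.assoc, b.s_comm, ← Category.assoc, a.s_comm,
        Category.assoc] }
  id_comp a := Hom.ext (funext fun n => Category.id_comp (a.f n))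
  comp_id a := Hom.ext (funext fun n => Category.comp_id (a.f n))
  assoc a b c := Hom.ext (funext fun n => Category.assoc (a.f n) (b.f n) (c.f n))

/-- An `n`-simplex of the hom simplicial set from `X` to `Y`: a family of morphisms
`x_φ : X_m ⟶ Y_m`, one for each monotone map `φ : [m] ⟶ [n]`, compatible with all the structure
maps. (The faces other than the last and the degeneracies generate the top-preserving maps.) -/
@[ext]
structure HomSimplex (X Y : TSimplicialObject T) (n : SimplexCategory) where
  /-- the component at `φ : [m] ⟶ [n]` -/
  app {m : ℕ} (φ : ⦋m⦌ ⟶ n) : X.X m ⟶ Y.X m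
  d_comm {m : ℕ} (φ : ⦋m + 1⦌ ⟶ n) (i : Fin (m + 1)) :
    app φ ≫ Y.d m i = X.d m i ≫ app (SimplexCategory.δ i.castSucc ≫ φ)
  dTop_comm {m : ℕ} (φ : ⦋m + 1⦌ ⟶ n) :
    app φ ≫ Y.dTop m = X.dTop m ≫ T.map (app (SimplexCategory.δ (Fin.last (m + 1)) ≫ φ))
  s_comm {m : ℕ} (φ : ⦋m⦌ ⟶ n) (i : Fin (m + 1)) :
    app φ ≫ Y.s m i = X.s m i ≫ app (SimplexCategory.σ i ≫ φ)

namespace HomSimplex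

/-- Restriction of a simplex along `θ : [k] ⟶ [n]`. -/
@[simps]
def pullback {X Y : TSimplicialObject T} {n k : SimplexCategory} (θ : k ⟶ n)
    (x : HomSimplex X Y n) : HomSimplex X Y k where
  app φ := x.app (φ ≫ θ)
  d_comm φ i := by rw [x.d_comm, Category.assoc]
  dTop_comm φ := by rw [x.dTop_comm, Category.assoc]
  s_comm φ i := by rw [x.s_comm, Category.assoc]

/-- The simplex constant at a morphism. -/
@[simps]
def ofHom {X Y : TSimplicialObject T} (a : X ⟶ Y) (n : SimplexCategory) : HomSimplex X Y n where
  app {m} _ := Hom.f a m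
  d_comm _ i := Hom.d_comm a _ i
  dTop_comm _ := Hom.dTop_comm a _
  s_comm _ i := Hom.s_comm a _ i

/-- Composition of simplices. -/
@[simps]
def comp {X Y Z : TSimplicialObject T} {n : SimplexCategory} (x : HomSimplex X Y n)
    (y : HomSimplex Y Z n) : HomSimplex X Z n where
  app φ := x.app φ ≫ y.app φ
  d_comm φ i := by rw [Category.assoc, y.d_comm, ← Category.assoc, x.d_comm, Category.assoc]
  dTop_comm φ := by rw [Category.assoc, y.dTop_comm, ← Category.assoc, x.dTop_comm,
    Category.assoc, T.map_comp]
  s_comm φ i := by rw [Category.assoc, y.s_comm, ← Category.assoc, x.s_comm, Category.assoc]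

end HomSimplex

/-- The hom simplicial set from `X` to `Y`. -/
def sHom (X Y : TSimplicialObject T) : SSet.{v} where
  obj n := HomSimplex X Y n.unop
  map θ := ↾(HomSimplex.pullback θ.unop)
  map_id n := by
    ext x m φ
    exact congrArg x.app (Category.comp_id φ)
  map_comp f g := by
    ext x m φ
    exact congrArg x.app (Category.assoc φ g.unop f.unop).symm

/-- Morphisms of `T`-simplicial objects are the `0`-simplices of the hom simplicial set. -/
def homEquivZero (X Y : TSimplicialObject T) : (X ⟶ Y) ≃ HomSimplex X Y ⦋0⦌ where
  toFun a := HomSimplex.ofHom a ⦋0⦌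
  invFun x :=
    { f := fun m => x.app (SimplexCategory.const ⦋m⦌ ⦋0⦌ 0)
      d_comm := fun n i => x.d_comm _ i
      dTop_comm := fun n => x.dTop_comm _
      s_comm := fun n i => x.s_comm _ i }
  left_inv a := rfl
  right_inv x := by
    refine HomSimplex.ext ?_
    funext m φ
    exact congrArg x.app (SimplexCategory.isTerminalZero.hom_ext _ _)

/-- The category of `T`-simplicial objects is enriched over simplicial sets, with identities and
composition defined componentwise. -/
instance : SimplicialCategory (TSimplicialObject T) where
  Hom := sHom
  id X := { app := fun n => ↾(fun _ => HomSimplex.ofHom (𝟙 X) n.unop) }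
  comp X Y Z := { app := fun n => ↾(fun p => HomSimplex.comp p.1 p.2) }
  id_comp X Y := by
    ext n x
    refine HomSimplex.ext ?_
    funext m φ
    exact Category.id_comp (x.app φ)
  comp_id X Y := by
    ext n x
    refine HomSimplex.ext ?_
    funext m φ
    exact Category.comp_id (x.app φ)
  assoc W X Y Z := by
    ext n x
    refine HomSimplex.ext ?_
    funext m φ
    exact Category.assoc (x.1.app φ) (x.2.1.app φ) (x.2.2.app φ)
  homEquiv {X Y} := (homEquivZero X Y).trans (sHom X Y).unitHomEquiv.symm
  homEquiv_id X := by
    ext n x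
    rfl
  homEquiv_comp a b := by
    ext n x
    rfl

/-- A `T`-category is a `T`-simplicial object satisfying the nerve condition: for all `n ≥ 0` the
square with sides `d_{n+2} : X_{n+2} ⟶ T X_{n+1}`, `d_0 : X_{n+2} ⟶ X_{n+1}`,
`T d_0 : T X_{n+1} ⟶ T X_n`, `d_{n+1} : X_{n+1} ⟶ T X_n` is a pullback. -/
def IsTCategory : ObjectProperty (TSimplicialObject T) := fun X =>
  ∀ n : ℕ, IsPullback (X.dTop (n + 1)) (X.d (n + 1) 0) (T.map (X.d n 0)) (X.dTop n)

end TSimplicialObject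

/-- The category `Cat_T(E)` of `T`-categories, the full (simplicial) subcategory of `s_T E`. -/
abbrev TCat {E : Type u} [Category.{v} E] (T : Monad E) :=
  ObjectProperty.FullSubcategory (TSimplicialObject.IsTCategory (T := T))

/-- The 2-category `Cat_T(E)`, as a category enriched over `Cat`. -/
noncomputable instance TCat.catEnriched {E : Type u} [Category.{v} E] (T : Monad E) :
    EnrichedOrdinaryCategory Cat.{v, v} (TCat T) :=
  TransportEnrichment.enrichedOrdinaryCategory (TCat T) SSet.hoFunctor.{v}
    (SSet.hoFunctor.unitHomEquiv · |>.trans <| Functor.equivCatHom _ _)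
      (congrArg (Functor.toCatHom) <| SSet.hoFunctor.unitHomEquiv_eq · ·)

/-! A map `W ⟶ X_1` is a generalized multi-arrow of `X`, with domain in `T X_0` and codomain in
`X_0`. For a `T`-category, a map `W ⟶ X_2` is a composable pair `g : W ⟶ X_1`, `f : W ⟶ T X_1`, and
its inner face is the composite; `IsComp` records this relation. As `T` need not preserve pullbacks,
matching families of arrows need not assemble into a map to `T X_2`. Associativity is thus available
only when the family of pairs is itself given as a map `b : W ⟶ T X_2` (`IsComp.assoc_left`,
`IsComp.assoc_right`). The theorem holds for every monad because all instances needed are of this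
kind; most often `b` is a unit applied to a pair (`assoc_unary`) or `T` applied to a map of pairs
(`assoc_map`).

The power of `X` by the 1-simplex has unary arrows as vertices. Its 1-simplices are commutative
squares, with a family of unary arrows on the domain and one unary arrow on the codomain, cut by a
diagonal into two 2-simplices. Level 2 is forced by the nerve condition, and squares compose by
pasting (`Power.exists_comp`). Three levels with associativity determine a whole `T`-category
(`Stage.nerve`).

Maps from `P` to a hom simplicial set are families `Fam P`. Into a `T`-category they are determined
by their values on edges (`Fam.ext_one`) and can be built from levels 0 and 1 (`Fam.extend`). The
universal property then amounts to cutting `Δ[1] × Δ[1]` into its two triangles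
(`Power.comp_cylinder_bijective`). Uniqueness of powers shows that every such power is a
`T`-category.

For the second claim, transformations between morphisms form a category, by unary associativity, and
its nerve is the hom simplicial set. The third follows by changing enrichment along the homotopy
category functor: it preserves finite products, every category is the homotopy category of its
nerve, and the hom objects are nerves, so powers are kept (`IsPower.transport`). -/

/-! ### Building a `T`-category from its three lowest levels -/

section Extension

variable {E : Type u} [Category.{v} E]

/-- The structure maps between two consecutive levels of a `T`-simplicial object. The faces and
degeneracies are indexed by natural numbers; only finitely many of them are meaningful. -/
structure Link (T : Monad E) (Y X : E) where
  /-- the faces other than the last one -/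
  d : ℕ → (Y ⟶ X)
  /-- the last face -/
  t : Y ⟶ T.obj X
  /-- the degeneracies -/
  s : ℕ → (X ⟶ Y)

namespace Link

variable {T : Monad E} {W X Y Z : E}

/-- The simplicial identities on a level `X = X_n` involving only `X_n` and `X_{n+1}`. -/
structure Unital (l : Link T Y X) (n : ℕ) : Prop where
  s_d_self (j : ℕ) (hj : j ≤ n) : l.s j ≫ l.d j = 𝟙 X
  s_d_succ (j : ℕ) (hj : j < n) : l.s j ≫ l.d (j + 1) = 𝟙 X
  s_t : l.s n ≫ l.t = T.η.app X

/-- The simplicial identities relating three levels `X = X_n`, `Y = X_{n+1}`, `Z = X_{n+2}`. -/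
structure Compat (k : Link T Z Y) (l : Link T Y X) (n : ℕ) : Prop where
  dd (i j : ℕ) (hij : i ≤ j) (hj : j ≤ n) : k.d i ≫ l.d j = k.d (j + 1) ≫ l.d i
  dt (i : ℕ) (hi : i ≤ n) : k.d i ≫ l.t = k.t ≫ T.map (l.d i)
  dtt : k.d (n + 1) ≫ l.t = k.t ≫ T.map l.t ≫ T.μ.app X
  ss (i j : ℕ) (hij : i ≤ j) (hj : j ≤ n) : l.s i ≫ k.s (j + 1) = l.s j ≫ k.s i
  sd_lt (i j : ℕ) (hij : i ≤ j) (hj : j ≤ n) : k.s (j + 1) ≫ k.d i = l.d i ≫ l.s j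
  sd_gt (i j : ℕ) (hij : j < i) (hi : i ≤ n) : k.s j ≫ k.d (i + 1) = l.d i ≫ l.s j
  st (j : ℕ) (hj : j ≤ n) : k.s j ≫ k.t = l.t ≫ T.map (l.s j)

/-- The nerve condition for three consecutive levels. -/
abbrev IsSegal (k : Link T Z Y) (l : Link T Y X) : Prop :=
  IsPullback k.t (k.d 0) (T.map (l.d 0)) l.t

section Next

variable {k : Link T Z Y} {l : Link T Y X} {n : ℕ}

/-- The simplicial identities force the two projections of every new face and degeneracy. This lemma
and the following ones say that the forced projections are compatible, so that the maps exist. -/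
lemma next_d_aux (c : k.Compat l n) {p : W ⟶ T.obj Z} {q : W ⟶ Z}
    (h : p ≫ T.map (k.d 0) = q ≫ k.t) (i : ℕ) (hi : i ≤ n) :
    (p ≫ T.map (k.d (i + 1))) ≫ T.map (l.d 0) = (q ≫ k.d i) ≫ l.t := by
  rw [Category.assoc, Category.assoc, ← T.map_comp, ← c.dd 0 i (Nat.zero_le _) hi, T.map_comp,
    reassoc_of% h, c.dt i hi]

lemma next_d_last_aux (c : k.Compat l n) {p : W ⟶ T.obj Z} {q : W ⟶ Z}
    (h : p ≫ T.map (k.d 0) = q ≫ k.t) :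
    (p ≫ T.map k.t ≫ T.μ.app Y) ≫ T.map (l.d 0) = (q ≫ k.d (n + 1)) ≫ l.t := by
  have hμ : T.μ.app Y ≫ T.map (l.d 0) = T.map (T.map (l.d 0)) ≫ T.μ.app X :=
    (T.μ.naturality (l.d 0)).symm
  rw [Category.assoc, Category.assoc, Category.assoc, hμ, ← T.map_comp_assoc,
    ← c.dt 0 (Nat.zero_le _), T.map_comp_assoc, reassoc_of% h, c.dtt]

lemma next_s_zero_aux (u : k.Unital (n + 1)) :
    (k.t ≫ T.map (k.s 0)) ≫ T.map (k.d 0) = 𝟙 Z ≫ k.t := by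
  rw [Category.assoc, ← T.map_comp, u.s_d_self 0 (Nat.zero_le _), T.map_id, Category.comp_id,
    Category.id_comp]

lemma next_s_aux (c : k.Compat l n) (j : ℕ) (hj : j ≤ n) :
    (k.t ≫ T.map (k.s (j + 1))) ≫ T.map (k.d 0) = (k.d 0 ≫ k.s j) ≫ k.t := by
  rw [Category.assoc, Category.assoc, ← T.map_comp, c.sd_lt 0 j (Nat.zero_le _) hj, T.map_comp,
    c.st j hj, ← Category.assoc, ← Category.assoc, c.dt 0 (Nat.zero_le _)]

lemma next_s_last_aux (u : k.Unital (n + 1)) :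
    T.η.app Z ≫ T.map (k.d 0) = (k.d 0 ≫ k.s (n + 1)) ≫ k.t := by
  rw [Category.assoc, u.s_t]
  exact (T.η.naturality (k.d 0)).symm

variable [HasPullbacks E]

/-- The next level of a `T`-category with the given structure maps. -/
noncomputable def nextObj (k : Link T Z Y) : E := pullback (T.map (k.d 0)) k.t

lemma next_isPullback (k : Link T Z Y) :
    IsPullback (pullback.fst _ _ : k.nextObj ⟶ T.obj Z) (pullback.snd _ _ : k.nextObj ⟶ Z)
      (T.map (k.d 0)) k.t :=
  IsPullback.of_hasPullback _ _

/-- The structure maps between the given levels and the next one. -/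
noncomputable def next (u : k.Unital (n + 1)) (c : k.Compat l n) (hZ : k.IsSegal l) :
    Link T k.nextObj Z where
  t := pullback.fst _ _
  d
  | 0 => pullback.snd _ _
  | i + 1 =>
      if hi : i ≤ n then hZ.lift _ _ (next_d_aux c k.next_isPullback.w i hi)
      -- Only `i = n + 1` matters here: this is the face just before the last one, whose identity
      -- against the last face involves `μ`. Larger indices carry junk values.
      else hZ.lift _ _ (next_d_last_aux c k.next_isPullback.w)
  s
  | 0 => k.next_isPullback.lift _ _ (next_s_zero_aux u)
  | j + 1 =>
      if hj : j ≤ n then k.next_isPullback.lift _ _ (next_s_aux c j hj)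
      -- The top degeneracy, `j = n + 1`: its last face is the unit.
      else k.next_isPullback.lift _ _ (next_s_last_aux u)

variable (u : k.Unital (n + 1)) (c : k.Compat l n) (hZ : k.IsSegal l)

lemma next_s_succ_eq (j : ℕ) (hj : j ≤ n) :
    (next u c hZ).s (j + 1) = k.next_isPullback.lift _ _ (next_s_aux c j hj) :=
  dif_pos hj

lemma next_s_last_eq :
    (next u c hZ).s (n + 2) = k.next_isPullback.lift _ _ (next_s_last_aux u) :=
  dif_neg (by omega)

lemma next_isSegal : (next u c hZ).IsSegal k := k.next_isPullback

lemma next_w : (next u c hZ).t ≫ T.map (k.d 0) = (next u c hZ).d 0 ≫ k.t :=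
  (next_isSegal u c hZ).w

lemma next_d_t (i : ℕ) (hi : i ≤ n + 1) :
    (next u c hZ).d i ≫ k.t = (next u c hZ).t ≫ T.map (k.d i) := by
  obtain _ | i := i
  · exact (next_w u c hZ).symm
  · simp only [next, dif_pos (show i ≤ n by omega)]
    exact hZ.lift_fst _ _ _

lemma next_d_last_t :
    (next u c hZ).d (n + 2) ≫ k.t = (next u c hZ).t ≫ T.map k.t ≫ T.μ.app Y := by
  simp only [next, dif_neg (show ¬ n + 1 ≤ n by omega)]
  exact hZ.lift_fst _ _ _

lemma next_d_succ_d_zero (i : ℕ) (hi : i ≤ n + 1) :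
    (next u c hZ).d (i + 1) ≫ k.d 0 = (next u c hZ).d 0 ≫ k.d i := by
  by_cases h : i ≤ n
  · simp only [next, dif_pos h]
    exact hZ.lift_snd _ _ _
  · obtain rfl : i = n + 1 := by omega
    simp only [next, dif_neg h]
    exact hZ.lift_snd _ _ _

lemma next_s_t (j : ℕ) (hj : j ≤ n + 1) :
    (next u c hZ).s j ≫ (next u c hZ).t = k.t ≫ T.map (k.s j) := by
  obtain _ | j := j
  · exact k.next_isPullback.lift_fst _ _ _
  · rw [next_s_succ_eq u c hZ j (by omega)]
    exact k.next_isPullback.lift_fst _ _ _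

lemma next_s_last_t : (next u c hZ).s (n + 2) ≫ (next u c hZ).t = T.η.app Z := by
  rw [next_s_last_eq]
  exact k.next_isPullback.lift_fst _ _ _

lemma next_s_zero_d_zero : (next u c hZ).s 0 ≫ (next u c hZ).d 0 = 𝟙 Z :=
  k.next_isPullback.lift_snd _ _ _

lemma next_s_succ_d_zero (j : ℕ) (hj : j ≤ n + 1) :
    (next u c hZ).s (j + 1) ≫ (next u c hZ).d 0 = k.d 0 ≫ k.s j := by
  by_cases h : j ≤ n
  · rw [next_s_succ_eq u c hZ j h]
    exact k.next_isPullback.lift_snd _ _ _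
  · obtain rfl : j = n + 1 := by omega
    rw [next_s_last_eq]
    exact k.next_isPullback.lift_snd _ _ _

/-- Equations between maps into `Z` are tested on its two projections, where they reduce to lower
identities and the unit laws of `T`. -/
lemma next_unital : (next u c hZ).Unital (n + 2) where
  s_d_self j hj := by
    refine hZ.hom_ext ?_ ?_
    · obtain rfl | h : j = n + 2 ∨ j ≤ n + 1 := by omega
      · rw [Category.assoc, next_d_last_t, reassoc_of% next_s_last_t, Category.id_comp]
        have := T.η.naturality k.t
        dsimp at this
        rw [← reassoc_of% this, T.left_unit]
        exact Category.comp_id _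
      · rw [Category.assoc, next_d_t _ _ _ _ h, reassoc_of% next_s_t _ _ _ _ h, ← T.map_comp,
          u.s_d_self j h, T.map_id, Category.comp_id, Category.id_comp]
    · obtain _ | j := j
      · rw [next_s_zero_d_zero]
      · rw [Category.assoc, next_d_succ_d_zero _ _ _ _ (by omega),
          reassoc_of% next_s_succ_d_zero _ _ _ _ (by omega), u.s_d_self j (by omega),
          Category.comp_id,
          Category.id_comp]
  s_d_succ j hj := by
    refine hZ.hom_ext ?_ ?_
    · obtain rfl | h : j = n + 1 ∨ j ≤ n := by omega
      · rw [Category.assoc, next_d_last_t, reassoc_of% next_s_t _ _ _ _ le_rfl, Category.id_comp,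
          ← T.map_comp_assoc, u.s_t, T.right_unit]
        exact Category.comp_id _
      · rw [Category.assoc, next_d_t _ _ _ _ (by omega), reassoc_of% next_s_t _ _ _ _ (by omega),
          ← T.map_comp, u.s_d_succ j (by omega), T.map_id, Category.comp_id, Category.id_comp]
    · obtain _ | j := j
      · rw [Category.assoc, next_d_succ_d_zero _ _ _ _ (by omega), reassoc_of% next_s_zero_d_zero,
          Category.id_comp]
      · rw [Category.assoc, next_d_succ_d_zero _ _ _ _ (by omega),
          reassoc_of% next_s_succ_d_zero _ _ _ _ (by omega), u.s_d_succ j (by omega),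
          Category.comp_id,
          Category.id_comp]
  s_t := next_s_last_t u c hZ

/-- Associativity, as a condition on the next level. -/
def NextAssoc : Prop :=
  ∀ i j : ℕ, i ≤ j → j ≤ n →
    (next u c hZ).d (i + 1) ≫ k.d (j + 1) = (next u c hZ).d (j + 2) ≫ k.d (i + 1)

/-- A face identity with both indices positive ends in `Y`, where no nerve condition is assumed;
this is why it has to be supplied as `ha`. All other identities are forced or can be tested on
projections. -/
lemma next_compat (ha : NextAssoc u c hZ) : (next u c hZ).Compat k (n + 1) where
  dd i j hij hj := by
    obtain _ | i := i
    · exact (next_d_succ_d_zero u c hZ j hj).symm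
    · obtain _ | j := j
      · omega
      · exact ha i j (by omega) (by omega)
  dt i hi := next_d_t u c hZ i hi
  dtt := next_d_last_t u c hZ
  ss i j hij hj := by
    refine (next_isSegal u c hZ).hom_ext ?_ ?_
    · obtain rfl | h : j = n + 1 ∨ j ≤ n := by omega
      · rw [Category.assoc, Category.assoc, next_s_last_t, next_s_t _ _ _ _ (by omega),
          ← Category.assoc, u.s_t]
        exact T.η.naturality (k.s i)
      · rw [Category.assoc, Category.assoc, next_s_t _ _ _ _ (by omega),
          next_s_t _ _ _ _ (by omega), reassoc_of% (c.st i (by omega)),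
          reassoc_of% (c.st j (by omega)), ← T.map_comp, ← T.map_comp, c.ss i j hij h]
    · obtain _ | i := i
      · rw [Category.assoc, Category.assoc, next_s_zero_d_zero, next_s_succ_d_zero _ _ _ _ hj,
          reassoc_of% (u.s_d_self 0 (by omega)), Category.comp_id]
      · obtain _ | j := j
        · omega
        · rw [Category.assoc, Category.assoc, next_s_succ_d_zero _ _ _ _ (by omega),
            next_s_succ_d_zero _ _ _ _ (by omega), reassoc_of% (c.sd_lt 0 i (by omega) (by omega)),
            reassoc_of% (c.sd_lt 0 j (by omega) (by omega)), c.ss i j (by omega) (by omega)]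
  sd_lt i j hij hj := by
    obtain _ | i := i
    · exact next_s_succ_d_zero u c hZ j hj
    refine hZ.hom_ext ?_ ?_
    · obtain rfl | h : j = n + 1 ∨ j ≤ n := by omega
      · rw [Category.assoc, Category.assoc, next_d_t _ _ _ _ (by omega),
          reassoc_of% next_s_last_t, u.s_t]
        exact (T.η.naturality _).symm
      · rw [Category.assoc, Category.assoc, next_d_t _ _ _ _ (by omega),
          reassoc_of% next_s_t _ _ _ _ (by omega), c.st j h, ← Category.assoc (k.d (i + 1)),
          c.dt (i + 1) (by omega), Category.assoc, ← T.map_comp, ← T.map_comp,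
          c.sd_lt (i + 1) j hij h]
    · obtain _ | j := j
      · omega
      · rw [Category.assoc, Category.assoc, next_d_succ_d_zero _ _ _ _ (by omega),
          reassoc_of% next_s_succ_d_zero _ _ _ _ (by omega), c.sd_lt 0 j (by omega) (by omega),
          c.sd_lt i j (by omega) (by omega), reassoc_of% (c.dd 0 i (by omega) (by omega))]
  sd_gt i j hij hi := by
    refine hZ.hom_ext ?_ ?_
    · obtain rfl | h : i = n + 1 ∨ i ≤ n := by omega
      · rw [Category.assoc, Category.assoc, next_d_last_t, reassoc_of% next_s_t _ _ _ _ (by omega),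
          c.st j (by omega), reassoc_of% c.dtt, ← T.map_comp_assoc, c.st j (by omega),
          T.map_comp, Category.assoc]
        congr 2
        exact T.μ.naturality (l.s j)
      · rw [Category.assoc, Category.assoc, next_d_t _ _ _ _ (by omega),
          reassoc_of% next_s_t _ _ _ _ (by omega), c.st j (by omega), ← Category.assoc (k.d i),
          c.dt i (by omega), Category.assoc, ← T.map_comp, ← T.map_comp, c.sd_gt i j hij h]
    · obtain _ | i := i
      · omega
      obtain _ | j := j
      · rw [Category.assoc, Category.assoc, next_d_succ_d_zero _ _ _ _ (by omega),
          reassoc_of% next_s_zero_d_zero, u.s_d_self 0 (by omega), Category.comp_id]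
      · rw [Category.assoc, Category.assoc, next_d_succ_d_zero _ _ _ _ (by omega),
          reassoc_of% next_s_succ_d_zero _ _ _ _ (by omega), c.sd_gt i j (by omega) (by omega),
          c.sd_lt 0 j (by omega) (by omega), reassoc_of% (c.dd 0 i (by omega) (by omega))]
  st j hj := next_s_t u c hZ j hj

/-- One level higher the identity ends in `Z`, which is a pullback, so it can be tested on
projections. Hence associativity has to be assumed at the lowest stage only. -/
lemma next_nextAssoc (ha : NextAssoc u c hZ) :
    NextAssoc (next_unital u c hZ) (next_compat u c hZ ha) (next_isSegal u c hZ) := by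
  intro i j hij hj
  have c' := next_compat u c hZ ha
  refine hZ.hom_ext ?_ ?_
  · obtain rfl | h : j = n + 1 ∨ j ≤ n := by omega
    · obtain rfl | h : i = n + 1 ∨ i ≤ n := by omega
      · rw [Category.assoc, Category.assoc, next_d_last_t, reassoc_of% next_d_t _ _ _ _ (by omega),
          reassoc_of% next_d_last_t, ← T.map_comp_assoc, next_d_last_t, T.map_comp, T.map_comp]
        have := T.μ.naturality k.t
        dsimp at this
        simp only [Category.assoc]
        rw [← reassoc_of% this, T.assoc]
      · rw [Category.assoc, Category.assoc, next_d_last_t, reassoc_of% next_d_t _ _ _ _ (by omega),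
          next_d_t _ _ _ _ (by omega), reassoc_of% next_d_last_t, ← T.map_comp_assoc,
          next_d_t _ _ _ _ (by omega), T.map_comp, Category.assoc]
        congr 2
        exact T.μ.naturality (k.d (i + 1))
    · rw [Category.assoc, Category.assoc, next_d_t _ _ _ _ (by omega),
        reassoc_of% next_d_t _ _ _ _ (by omega), next_d_t _ _ _ _ (by omega),
        reassoc_of% next_d_t _ _ _ _ (by omega), ← T.map_comp, ← T.map_comp,
        c'.dd (i + 1) (j + 1) (by omega) (by omega)]
  · rw [Category.assoc, Category.assoc, next_d_succ_d_zero _ _ _ _ (by omega),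
      reassoc_of% next_d_succ_d_zero _ _ _ _ (by omega), next_d_succ_d_zero _ _ _ _ (by omega),
      reassoc_of% next_d_succ_d_zero _ _ _ _ (by omega), c'.dd i j hij hj]

end Next

end Link

/-- Three consecutive levels of a `T`-category, together with associativity on the next level. -/
structure Stage (T : Monad E) [HasPullbacks E] (n : ℕ) where
  /-- the objects of `n`-simplices -/
  X : E
  /-- the objects of `n+1`-simplices -/
  Y : E
  /-- the objects of `n+2`-simplices -/
  Z : E
  /-- the lower structure maps -/
  l : Link T Y X
  /-- the upper structure maps -/
  k : Link T Z Y
  unital_l : l.Unital n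
  unital_k : k.Unital (n + 1)
  compat : k.Compat l n
  isSegal : k.IsSegal l
  assoc : Link.NextAssoc unital_k compat isSegal

namespace Stage

variable {T : Monad E} [HasPullbacks E]

/-- The stage one level higher. -/
noncomputable def succ {n : ℕ} (S : Stage T n) : Stage T (n + 1) where
  X := S.Y
  Y := S.Z
  Z := S.k.nextObj
  l := S.k
  k := Link.next S.unital_k S.compat S.isSegal
  unital_l := S.unital_k
  unital_k := Link.next_unital _ _ _
  compat := Link.next_compat _ _ _ S.assoc
  isSegal := Link.next_isSegal _ _ _
  assoc := Link.next_nextAssoc _ _ _ S.assoc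

/-- All stages determined by the lowest one. -/
noncomputable def tower (S : Stage T 0) (n : ℕ) : Stage T n :=
  Nat.rec S (fun _ R => R.succ) n

/-- The nerve of the lowest stage. -/
noncomputable def nerve (S : Stage T 0) : TSimplicialObject T where
  X n := (S.tower n).X
  d n i := (S.tower n).l.d i
  dTop n := (S.tower n).l.t
  s n i := (S.tower n).l.s i
  d_comp_d n i j hij := (S.tower n).compat.dd i j hij (by omega)
  d_comp_dTop n i := (S.tower n).compat.dt i (by omega)
  d_last_comp_dTop n := (S.tower n).compat.dtt
  s_comp_s n i j hij := (S.tower n).compat.ss i j hij (by omega)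
  s_comp_d_of_lt n i j hij := (S.tower n).compat.sd_lt i j hij (by omega)
  s_comp_d_self n j := (S.tower n).unital_l.s_d_self j (by omega)
  s_comp_d_succ n j := (S.tower n).unital_l.s_d_succ j (by omega)
  s_last_comp_dTop n := (S.tower n).unital_l.s_t
  s_comp_d_of_gt n i j hij := (S.tower n).compat.sd_gt i j hij (by omega)
  s_comp_dTop n j := (S.tower n).compat.st j (by omega)

lemma nerve_isTCategory (S : Stage T 0) : S.nerve.IsTCategory :=
  fun n => (S.tower n).isSegal

end Stage

end Extension

/-! ### Composition in a `T`-category and the available forms of associativity -/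

namespace TSimplicialObject

variable {E : Type u} [Category.{v} E] {T : Monad E} {X Y : TSimplicialObject T}

section Composition

variable {V W : E}

/-- The generalized `1`-simplex `k` of `X` is the composite of `g` and the family `f`: there is a
`2`-simplex with these faces. -/
def IsComp (X : TSimplicialObject T) (g : W ⟶ X.X 1) (f : W ⟶ T.obj (X.X 1)) (k : W ⟶ X.X 1) :
    Prop :=
  ∃ a : W ⟶ X.X 2, a ≫ X.d 1 0 = g ∧ a ≫ X.dTop 1 = f ∧ a ≫ X.d 1 1 = k

lemma IsComp.of_simplex (a : W ⟶ X.X 2) :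
    X.IsComp (a ≫ X.d 1 0) (a ≫ X.dTop 1) (a ≫ X.d 1 1) :=
  ⟨a, rfl, rfl, rfl⟩

lemma d_one_zero_comp_d : X.d 1 0 ≫ X.d 0 0 = X.d 1 1 ≫ X.d 0 0 :=
  X.d_comp_d 0 0 0 le_rfl

lemma d_one_zero_comp_dTop : X.d 1 0 ≫ X.dTop 0 = X.dTop 1 ≫ T.map (X.d 0 0) :=
  X.d_comp_dTop 0 0

lemma d_one_one_comp_dTop :
    X.d 1 1 ≫ X.dTop 0 = X.dTop 1 ≫ T.map (X.dTop 0) ≫ T.μ.app (X.X 0) :=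
  X.d_last_comp_dTop 0

lemma s_zero_comp_d : X.s 0 0 ≫ X.d 0 0 = 𝟙 _ :=
  X.s_comp_d_self 0 0

lemma s_zero_comp_dTop : X.s 0 0 ≫ X.dTop 0 = T.η.app _ :=
  X.s_last_comp_dTop 0

lemma μ_naturality {A B : E} (f : A ⟶ B) :
    T.map (T.map f) ≫ T.μ.app B = T.μ.app A ≫ T.map f :=
  T.μ.naturality f

lemma η_naturality {A B : E} (f : A ⟶ B) : T.η.app A ≫ T.map f = f ≫ T.η.app B :=
  (T.η.naturality f).symm

lemma η_map_μ (A : E) : T.map (T.η.app A) ≫ T.μ.app A = 𝟙 (T.obj A) :=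
  T.right_unit A

lemma η_μ (A : E) : T.η.app (T.obj A) ≫ T.μ.app A = 𝟙 (T.obj A) :=
  T.left_unit A

namespace IsComp

variable {g : W ⟶ X.X 1} {f : W ⟶ T.obj (X.X 1)} {k k' : W ⟶ X.X 1}

lemma cod (h : X.IsComp g f k) : k ≫ X.d 0 0 = g ≫ X.d 0 0 := by
  obtain ⟨a, rfl, rfl, rfl⟩ := h
  rw [Category.assoc, Category.assoc, d_one_zero_comp_d]

lemma dom (h : X.IsComp g f k) :
    k ≫ X.dTop 0 = f ≫ T.map (X.dTop 0) ≫ T.μ.app (X.X 0) := by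
  obtain ⟨a, rfl, rfl, rfl⟩ := h
  rw [Category.assoc, Category.assoc, d_one_one_comp_dTop]

lemma precomp (h : X.IsComp g f k) (r : V ⟶ W) : X.IsComp (r ≫ g) (r ≫ f) (r ≫ k) := by
  obtain ⟨a, rfl, rfl, rfl⟩ := h
  exact ⟨r ≫ a, by simp, by simp, by simp⟩

lemma exists_of (hX : X.IsTCategory) (h : g ≫ X.dTop 0 = f ≫ T.map (X.d 0 0)) :
    ∃ k, X.IsComp g f k :=
  ⟨_, (hX 0).lift f g h.symm, (hX 0).lift_snd _ _ _, (hX 0).lift_fst _ _ _, rfl⟩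

lemma unique (hX : X.IsTCategory) (h : X.IsComp g f k) (h' : X.IsComp g f k') : k = k' := by
  obtain ⟨a, rfl, rfl, rfl⟩ := h
  obtain ⟨b, h₁, h₂, rfl⟩ := h'
  obtain rfl : b = a := (hX 0).hom_ext h₂ h₁
  rfl

lemma simplex (hX : X.IsTCategory) (a : W ⟶ X.X 2) (h : X.IsComp (a ≫ X.d 1 0) (a ≫ X.dTop 1) k) :
    a ≫ X.d 1 1 = k :=
  (of_simplex a).unique hX h

lemma id_left (k : W ⟶ X.X 1) :
    X.IsComp (k ≫ X.d 0 0 ≫ X.s 0 0) (k ≫ T.η.app _) k := by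
  refine ⟨k ≫ X.s 1 1, ?_, ?_, ?_⟩
  · exact (Category.assoc _ _ _).trans (congrArg _ (X.s_comp_d_of_lt 0 0 0 le_rfl))
  · exact (Category.assoc _ _ _).trans (congrArg _ (X.s_last_comp_dTop 1))
  · refine (Category.assoc _ _ _).trans ?_
    rw [X.s_comp_d_self 1 1, Category.comp_id]

lemma id_right (k : W ⟶ X.X 1) :
    X.IsComp k (k ≫ X.dTop 0 ≫ T.map (X.s 0 0)) k := by
  refine ⟨k ≫ X.s 1 0, ?_, ?_, ?_⟩
  · refine (Category.assoc _ _ _).trans ?_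
    rw [X.s_comp_d_self 1 0, Category.comp_id]
  · exact (Category.assoc _ _ _).trans (congrArg _ (X.s_comp_dTop 0 0))
  · refine (Category.assoc _ _ _).trans ?_
    have := X.s_comp_d_succ 1 0
    dsimp at this
    rw [this, Category.comp_id]

/-- Associativity of composition, with a given family `b` of composable pairs. -/
lemma assoc_left (hX : X.IsTCategory) {ab : W ⟶ X.X 1} {b : W ⟶ T.obj (X.X 2)}
    (h₁ : X.IsComp g (b ≫ T.map (X.d 1 0)) ab)
    (h₂ : X.IsComp ab (b ≫ T.map (X.dTop 1) ≫ T.μ.app _) k) :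
    X.IsComp g (b ≫ T.map (X.d 1 1)) k := by
  obtain ⟨a, rfl, ha, rfl⟩ := h₁
  -- The 3-simplex with last face `b`; forming it needs an actual map to `T X_2`. Its faces `d_1`
  -- and `d_2` are the two bracketings.
  let c : W ⟶ X.X 3 := (hX 1).lift b a ha.symm
  have c₀ : c ≫ X.d 2 0 = a := (hX 1).lift_snd _ _ _
  have c₃ : c ≫ X.dTop 2 = b := (hX 1).lift_fst _ _ _
  have e₀ : X.d 2 0 ≫ X.d 1 0 = X.d 2 1 ≫ X.d 1 0 := X.d_comp_d 1 0 0 le_rfl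
  have e₁ : X.d 2 0 ≫ X.d 1 1 = X.d 2 2 ≫ X.d 1 0 := X.d_comp_d 1 0 1 (by simp)
  have e₂ : X.d 2 1 ≫ X.d 1 1 = X.d 2 2 ≫ X.d 1 1 := X.d_comp_d 1 1 1 le_rfl
  have e₃ : X.d 2 1 ≫ X.dTop 1 = X.dTop 2 ≫ T.map (X.d 1 1) := X.d_comp_dTop 1 1
  have e₄ : X.d 2 2 ≫ X.dTop 1 = X.dTop 2 ≫ T.map (X.dTop 1) ≫ T.μ.app _ := X.d_last_comp_dTop 1
  refine ⟨c ≫ X.d 2 1, ?_, ?_, ?_⟩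
  · rw [Category.assoc, ← e₀, reassoc_of% c₀]
  · rw [Category.assoc, e₃, reassoc_of% c₃]
  · rw [Category.assoc, e₂, ← Category.assoc]
    refine simplex hX _ ?_
    rwa [Category.assoc, Category.assoc, ← e₁, e₄, reassoc_of% c₀, reassoc_of% c₃]

/-- Associativity of composition, with a given family `b` of composable pairs. -/
lemma assoc_right (hX : X.IsTCategory) {ab : W ⟶ X.X 1} {b : W ⟶ T.obj (X.X 2)}
    (h₁ : X.IsComp g (b ≫ T.map (X.d 1 0)) ab)
    (h₂ : X.IsComp g (b ≫ T.map (X.d 1 1)) k) :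
    X.IsComp ab (b ≫ T.map (X.dTop 1) ≫ T.μ.app _) k := by
  -- Some composite `k'` exists; `assoc_left` and uniqueness identify it with `k`.
  obtain ⟨k', hk'⟩ := exists_of (g := ab) (f := b ≫ T.map (X.dTop 1) ≫ T.μ.app _) hX (by
    rw [h₁.dom, Category.assoc, Category.assoc, Category.assoc, ← μ_naturality,
      ← T.map_comp_assoc, ← T.map_comp_assoc, d_one_zero_comp_dTop])
  obtain rfl := (assoc_left hX h₁ hk').unique hX h₂
  exact hk'

/-- Associativity for a composable triple `g`, `f`, `x` with `f` unary, and `x` arbitrary. -/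
lemma assoc_unary (hX : X.IsTCategory) {h : W ⟶ X.X 1} {x : W ⟶ T.obj (X.X 1)}
    {gh hx : W ⟶ X.X 1}
    (h₁ : X.IsComp g (h ≫ T.η.app _) gh) (h₂ : X.IsComp h x hx) :
    X.IsComp g (hx ≫ T.η.app _) k ↔ X.IsComp gh x k := by
  -- The required family of pairs is `b ≫ η`, a single pair seen as a family.
  obtain ⟨b, rfl, rfl, rfl⟩ := h₂
  have e₀ : (b ≫ X.d 1 0) ≫ T.η.app _ = (b ≫ T.η.app _) ≫ T.map (X.d 1 0) := by
    rw [Category.assoc, Category.assoc, η_naturality]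
  have e₁ : (b ≫ X.d 1 1) ≫ T.η.app _ = (b ≫ T.η.app _) ≫ T.map (X.d 1 1) := by
    rw [Category.assoc, Category.assoc, η_naturality]
  have e₂ : b ≫ X.dTop 1 = (b ≫ T.η.app _) ≫ T.map (X.dTop 1) ≫ T.μ.app _ := by
    rw [Category.assoc, reassoc_of% η_naturality (X.dTop 1), η_μ, Category.comp_id]
  rw [e₀] at h₁
  rw [e₁, e₂]
  exact ⟨fun h => assoc_right hX h₁ h, fun h => assoc_left hX h₁ h⟩

/-- Associativity for a composable triple `g`, `f`, `x` with `x` a family of unary simplices. -/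
lemma assoc_map (hX : X.IsTCategory) {y : W ⟶ T.obj V} {f x fx : V ⟶ X.X 1} {gf : W ⟶ X.X 1}
    (h₁ : X.IsComp g (y ≫ T.map f) gf) (h₂ : X.IsComp f (x ≫ T.η.app _) fx) :
    X.IsComp g (y ≫ T.map fx) k ↔ X.IsComp gf (y ≫ T.map x) k := by
  obtain ⟨b, rfl, hb, rfl⟩ := h₂
  -- The required family of pairs is `y ≫ T.map b`.
  have e₂ : y ≫ T.map x = (y ≫ T.map b) ≫ T.map (X.dTop 1) ≫ T.μ.app _ := by
    rw [Category.assoc, ← T.map_comp_assoc, hb, T.map_comp, Category.assoc, η_map_μ,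
      Category.comp_id]
  rw [T.map_comp, ← Category.assoc] at h₁
  rw [T.map_comp, ← Category.assoc, e₂]
  exact ⟨fun h => assoc_right hX h₁ h, fun h => assoc_left hX h₁ h⟩

end IsComp

end Composition

/-! ### Families indexed by a simplicial set, and their determination by low levels -/

/-- A family of morphisms from `Y` to `X` indexed by the simplices of `P`, compatible with all
structure maps; these are the maps of simplicial sets from `P` to the hom from `Y` to `X`. -/
structure Fam (P : SSet.{w}) (Y X : TSimplicialObject T) where
  /-- the components -/
  z {m : ℕ} (p : P _⦋m⦌) : Y.X m ⟶ X.X m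
  d_comm {m : ℕ} (p : P _⦋m + 1⦌) (i : Fin (m + 1)) :
    z p ≫ X.d m i = Y.d m i ≫ z (P.δ i.castSucc p)
  dTop_comm {m : ℕ} (p : P _⦋m + 1⦌) :
    z p ≫ X.dTop m = Y.dTop m ≫ T.map (z (P.δ (Fin.last (m + 1)) p))
  s_comm {m : ℕ} (p : P _⦋m⦌) (i : Fin (m + 1)) :
    z p ≫ X.s m i = Y.s m i ≫ z (P.σ i p)

namespace Fam

variable {P : SSet.{w}}

@[ext]
lemma ext {a b : Fam P Y X} (h : ∀ (m : ℕ) (p : P _⦋m⦌), a.z p = b.z p) : a = b := by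
  obtain ⟨z, _, _, _⟩ := a
  obtain ⟨z', _, _, _⟩ := b
  obtain rfl : @z = @z' := by
    funext m p
    exact h m p
  rfl

lemma z_zero_eq (a : Fam P Y X) (p : P _⦋0⦌) : a.z p = Y.s 0 0 ≫ a.z (P.σ 0 p) ≫ X.d 0 0 := by
  rw [← Category.assoc, ← a.s_comm, Category.assoc, s_zero_comp_d, Category.comp_id]

/-- A vertex is a face of its degenerate edge, and from level 2 on the nerve condition recovers a
value from its face `d_0` and its last face. -/
lemma ext_one (hX : X.IsTCategory) {a b : Fam P Y X} (h : ∀ p : P _⦋1⦌, a.z p = b.z p) :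
    a = b := by
  ext m p
  induction m with
  | zero => rw [a.z_zero_eq, b.z_zero_eq, h]
  | succ m ih =>
    obtain _ | m := m
    · exact h p
    · refine (hX m).hom_ext ?_ ?_
      · rw [a.dTop_comm, b.dTop_comm, ih]
      · rw [a.d_comm, b.d_comm, ih]

lemma isComp (a : Fam P Y X) (p : P _⦋2⦌) :
    X.IsComp (Y.d 1 0 ≫ a.z (P.δ 0 p)) (Y.dTop 1 ≫ T.map (a.z (P.δ 2 p)))
      (Y.d 1 1 ≫ a.z (P.δ 1 p)) :=
  ⟨a.z p, a.d_comm p 0, a.dTop_comm p, a.d_comm p 1⟩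

section Extend

/-- Two consecutive levels of a family. -/
structure Level (P : SSet.{w}) (Y X : TSimplicialObject T) (n : ℕ) where
  /-- the lower level -/
  a : P _⦋n⦌ → (Y.X n ⟶ X.X n)
  /-- the upper level -/
  b : P _⦋n + 1⦌ → (Y.X (n + 1) ⟶ X.X (n + 1))
  d_zero (p : P _⦋n + 1⦌) : b p ≫ X.d n 0 = Y.d n 0 ≫ a (P.δ 0 p)
  dTop (p : P _⦋n + 1⦌) : b p ≫ X.dTop n = Y.dTop n ≫ T.map (a (P.δ (Fin.last (n + 1)) p))

namespace Level

variable (hX : X.IsTCategory)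

lemma succ_aux {n : ℕ} (l : Level P Y X n) (p : P _⦋n + 2⦌) :
    (Y.dTop (n + 1) ≫ T.map (l.b (P.δ (Fin.last (n + 2)) p))) ≫ T.map (X.d n 0) =
      (Y.d (n + 1) 0 ≫ l.b (P.δ 0 p)) ≫ X.dTop n := by
  have h := P.δ_comp_δ_apply (i := 0) (j := Fin.last (n + 1)) (Fin.zero_le _) p
  have h' := Y.d_comp_dTop n 0
  simp only [Fin.succ_last, Fin.castSucc_zero] at h h'
  rw [Category.assoc, Category.assoc, ← T.map_comp, l.d_zero, l.dTop, reassoc_of% h', T.map_comp, h]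

/-- The next two levels. -/
noncomputable def succ {n : ℕ} (l : Level P Y X n) : Level P Y X (n + 1) where
  a := l.b
  b p := (hX n).lift _ _ (l.succ_aux p)
  d_zero _ := (hX n).lift_snd _ _ _
  dTop _ := (hX n).lift_fst _ _ _

/-- All levels determined by the lowest two. -/
noncomputable def tower (l : Level P Y X 0) (n : ℕ) : Level P Y X n :=
  Nat.rec l (fun _ r => r.succ hX) n

end Level

variable (hX : X.IsTCategory) (l : Level P Y X 0)
  (hs : ∀ p : P _⦋0⦌, l.a p ≫ X.s 0 0 = Y.s 0 0 ≫ l.b (P.σ 0 p))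
  (hc : ∀ p : P _⦋2⦌, X.IsComp (Y.d 1 0 ≫ l.b (P.δ 0 p)) (Y.dTop 1 ≫ T.map (l.b (P.δ 2 p)))
      (Y.d 1 1 ≫ l.b (P.δ 1 p)))

/-- The components of the family determined by its lowest two levels. -/
noncomputable def extendZ {m : ℕ} (p : P _⦋m⦌) : Y.X m ⟶ X.X m := (l.tower hX m).a p

lemma extendZ_d_zero {m : ℕ} (p : P _⦋m + 1⦌) :
    extendZ hX l p ≫ X.d m 0 = Y.d m 0 ≫ extendZ hX l (P.δ 0 p) :=
  (l.tower hX m).d_zero p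

lemma extendZ_dTop {m : ℕ} (p : P _⦋m + 1⦌) :
    extendZ hX l p ≫ X.dTop m =
      Y.dTop m ≫ T.map (extendZ hX l (P.δ (Fin.last (m + 1)) p)) :=
  (l.tower hX m).dTop p

-- Comparing `d_0` and last faces lowers the dimension by one. This fails only for the inner face of
-- a 2-simplex, which ends in `X_1`; there `hc` is needed.
include hc in
lemma extendZ_d {m : ℕ} (p : P _⦋m + 1⦌) (i : Fin (m + 1)) :
    extendZ hX l p ≫ X.d m i = Y.d m i ≫ extendZ hX l (P.δ i.castSucc p) := by
  induction m with
  | zero =>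
    obtain rfl : i = 0 := Fin.fin_one_eq_zero i
    exact extendZ_d_zero hX l p
  | succ m ih =>
    obtain rfl | ⟨i, rfl⟩ := i.eq_zero_or_eq_succ
    · exact extendZ_d_zero hX l p
    obtain _ | m := m
    · obtain rfl : i = 0 := Fin.fin_one_eq_zero i
      refine IsComp.simplex hX (extendZ hX l p) ?_
      rw [extendZ_d_zero, extendZ_dTop]
      exact hc p
    refine (hX m).hom_ext ?_ ?_
    · obtain ⟨j, hj⟩ | hi := i.succ.eq_castSucc_or_eq_last
      · rw [hj, Category.assoc, X.d_comp_dTop, reassoc_of% extendZ_dTop hX l p, ← T.map_comp, ih,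
          Category.assoc, extendZ_dTop, T.map_comp, reassoc_of% Y.d_comp_dTop (m + 1) j]
        have h := P.δ_comp_δ_apply (i := j.castSucc) (j := Fin.last (m + 2)) (Fin.le_last _) p
        simp only [Fin.succ_last] at h
        rw [h]
      · rw [hi, Category.assoc, X.d_last_comp_dTop, reassoc_of% extendZ_dTop hX l p,
          ← T.map_comp_assoc, extendZ_dTop, Category.assoc, extendZ_dTop,
          reassoc_of% Y.d_last_comp_dTop (m + 1), T.map_comp, Category.assoc, μ_naturality]
        have h := P.δ_comp_δ_self_apply (i := Fin.last (m + 2)) p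
        simp only [Fin.succ_last] at h
        rw [h]
    · have h := X.d_comp_d (m + 1) 0 i (Fin.zero_le _)
      have h' := Y.d_comp_d (m + 1) 0 i (Fin.zero_le _)
      have h'' := P.δ_comp_δ_apply (i := 0) (j := i.castSucc) (Fin.zero_le _) p
      simp only [Fin.castSucc_zero] at h h' h''
      rw [Category.assoc, ← h, reassoc_of% extendZ_d_zero hX l p, ih, Category.assoc,
        extendZ_d_zero, reassoc_of% h', ← h'', Fin.succ_castSucc]

include hs in
lemma extendZ_s {m : ℕ} (p : P _⦋m⦌) (i : Fin (m + 1)) :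
    extendZ hX l p ≫ X.s m i = Y.s m i ≫ extendZ hX l (P.σ i p) := by
  induction m with
  | zero =>
    obtain rfl : i = 0 := Fin.fin_one_eq_zero i
    exact hs p
  | succ m ih =>
    refine (hX m).hom_ext ?_ ?_
    · obtain ⟨j, rfl⟩ | rfl := i.eq_castSucc_or_eq_last
      · rw [Category.assoc, X.s_comp_dTop, Category.assoc, extendZ_dTop,
          reassoc_of% extendZ_dTop hX l p, ← T.map_comp, ih, T.map_comp,
          reassoc_of% Y.s_comp_dTop m j]
        have h := P.δ_comp_σ_of_gt_apply (i := Fin.last (m + 1)) (j := j)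
          (Fin.castSucc_lt_last _) p
        simp only [Fin.succ_last] at h
        rw [h]
      · rw [Category.assoc, X.s_last_comp_dTop, Category.assoc, extendZ_dTop,
          reassoc_of% Y.s_last_comp_dTop (m + 1), η_naturality]
        have h := P.δ_comp_σ_succ_apply (Fin.last (m + 1)) p
        simp only [Fin.succ_last] at h
        rw [h]
    · obtain rfl | ⟨j, rfl⟩ := i.eq_zero_or_eq_succ
      · rw [Category.assoc, X.s_comp_d_self, Category.assoc, extendZ_d_zero,
          reassoc_of% Y.s_comp_d_self (m + 1) 0, Category.comp_id]
        have h := P.δ_comp_σ_self_apply 0 p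
        simp only [Fin.castSucc_zero] at h
        rw [h]
      · have h := X.s_comp_d_of_lt m 0 j (Fin.zero_le _)
        have h' := Y.s_comp_d_of_lt m 0 j (Fin.zero_le _)
        have h'' := P.δ_comp_σ_of_le_apply (i := 0) (j := j) (Fin.zero_le _) p
        simp only [Fin.castSucc_zero] at h h' h''
        rw [Category.assoc, h, reassoc_of% extendZ_d_zero hX l p, ih, Category.assoc,
          extendZ_d_zero, reassoc_of% h', h'']

/-- The family determined by its lowest two levels. -/
noncomputable def extend : Fam P Y X where
  z := extendZ hX l
  d_comm := extendZ_d hX l hc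
  dTop_comm := extendZ_dTop hX l
  s_comm := extendZ_s hX l hs

end Extend

end Fam

end TSimplicialObject

/-! ### The power by the 1-simplex: unary arrows and squares -/

namespace TSimplicialObject

variable {E : Type u} [Category.{v} E] {T : Monad E} [HasPullbacks E]

namespace Power

variable (X : TSimplicialObject T)

/-- The object of unary `1`-simplices of `X`. -/
noncomputable def obj₀ : E := pullback (X.dTop 0) (T.η.app (X.X 0))

/-- The underlying `1`-simplex of a unary `1`-simplex. -/
noncomputable def arr : obj₀ X ⟶ X.X 1 := pullback.fst _ _

/-- The source of a unary `1`-simplex. -/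
noncomputable def src : obj₀ X ⟶ X.X 0 := pullback.snd _ _

/-- The target of a unary `1`-simplex. -/
noncomputable def tgt : obj₀ X ⟶ X.X 0 := arr X ≫ X.d 0 0

lemma isPullback₀ : IsPullback (arr X) (src X) (X.dTop 0) (T.η.app (X.X 0)) :=
  IsPullback.of_hasPullback _ _

lemma arr_dTop : arr X ≫ X.dTop 0 = src X ≫ T.η.app (X.X 0) := (isPullback₀ X).w

/-- Pairs of a `1`-simplex followed by a unary one. -/
noncomputable def lower : E := pullback (X.dTop 1) (T.η.app (X.X 1))

/-- Pairs of a family of unary `1`-simplices followed by a `1`-simplex. -/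
noncomputable def upper : E := pullback (X.dTop 1) (T.map (arr X))

/-- The `2`-simplex underlying an element of `lower X`. -/
noncomputable def lowerFst : lower X ⟶ X.X 2 := pullback.fst _ _

/-- The `1`-simplex underlying an element of `lower X`. -/
noncomputable def lowerSnd : lower X ⟶ X.X 1 := pullback.snd _ _

/-- The `2`-simplex underlying an element of `upper X`. -/
noncomputable def upperFst : upper X ⟶ X.X 2 := pullback.fst _ _

/-- The family of unary `1`-simplices underlying an element of `upper X`. -/
noncomputable def upperSnd : upper X ⟶ T.obj (obj₀ X) := pullback.snd _ _

lemma isPullback_lower :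
    IsPullback (lowerFst X) (lowerSnd X) (X.dTop 1) (T.η.app (X.X 1)) :=
  IsPullback.of_hasPullback _ _

lemma isPullback_upper :
    IsPullback (upperFst X) (upperSnd X) (X.dTop 1) (T.map (arr X)) :=
  IsPullback.of_hasPullback _ _

/-- The object of commutative squares with two opposite unary sides. -/
noncomputable def obj₁ : E := pullback (lowerFst X ≫ X.d 1 1) (upperFst X ≫ X.d 1 1)

/-- The projection of a square to its lower half. -/
noncomputable def toLower : obj₁ X ⟶ lower X := pullback.fst _ _

/-- The projection of a square to its upper half. -/
noncomputable def toUpper : obj₁ X ⟶ upper X := pullback.snd _ _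

lemma isPullback₁ :
    IsPullback (toLower X) (toUpper X) (lowerFst X ≫ X.d 1 1) (upperFst X ≫ X.d 1 1) :=
  IsPullback.of_hasPullback _ _

/-- The lower half of a square. -/
noncomputable def lo : obj₁ X ⟶ X.X 2 := toLower X ≫ lowerFst X

/-- The upper half of a square. -/
noncomputable def up : obj₁ X ⟶ X.X 2 := toUpper X ≫ upperFst X

/-- The source side of a square. -/
noncomputable def srcMap : obj₁ X ⟶ X.X 1 := toLower X ≫ lowerSnd X

/-- The domain of a square. -/
noncomputable def dom : obj₁ X ⟶ T.obj (obj₀ X) := toUpper X ≫ upperSnd X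

/-- The target side of a square. -/
noncomputable def tgtMap : obj₁ X ⟶ X.X 1 := up X ≫ X.d 1 0

/-- The diagonal of a square. -/
noncomputable def diag : obj₁ X ⟶ X.X 1 := lo X ≫ X.d 1 1

lemma lo_dTop : lo X ≫ X.dTop 1 = srcMap X ≫ T.η.app (X.X 1) := by
  rw [lo, srcMap, Category.assoc, Category.assoc, (isPullback_lower X).w]

lemma up_dTop : up X ≫ X.dTop 1 = dom X ≫ T.map (arr X) := by
  rw [up, dom, Category.assoc, Category.assoc, (isPullback_upper X).w]

lemma up_d_one : up X ≫ X.d 1 1 = diag X := by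
  rw [diag, lo, up, Category.assoc, Category.assoc, (isPullback₁ X).w]

variable {X} in
lemma exists_lift₁ {W : E} (a b : W ⟶ X.X 2) (f : W ⟶ X.X 1) (q : W ⟶ T.obj (obj₀ X))
    (ha : a ≫ X.dTop 1 = f ≫ T.η.app _) (hb : b ≫ X.dTop 1 = q ≫ T.map (arr X))
    (hab : a ≫ X.d 1 1 = b ≫ X.d 1 1) :
    ∃ c : W ⟶ obj₁ X, c ≫ lo X = a ∧ c ≫ up X = b ∧ c ≫ srcMap X = f ∧ c ≫ dom X = q := by
  have h₁ := (isPullback_lower X).lift_fst a f ha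
  have h₂ := (isPullback_upper X).lift_fst b q hb
  have h : (isPullback_lower X).lift a f ha ≫ lowerFst X ≫ X.d 1 1 =
      (isPullback_upper X).lift b q hb ≫ upperFst X ≫ X.d 1 1 := by
    rw [reassoc_of% h₁, reassoc_of% h₂, hab]
  refine ⟨(isPullback₁ X).lift _ _ h, ?_, ?_, ?_, ?_⟩
  · rw [lo, (isPullback₁ X).lift_fst_assoc, h₁]
  · rw [up, (isPullback₁ X).lift_snd_assoc, h₂]
  · rw [srcMap, (isPullback₁ X).lift_fst_assoc, (isPullback_lower X).lift_snd]
  · rw [dom, (isPullback₁ X).lift_snd_assoc, (isPullback_upper X).lift_snd]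

/-- The codomain of a square. -/
noncomputable def cod : obj₁ X ⟶ obj₀ X :=
  (isPullback₀ X).lift (lo X ≫ X.d 1 0) (srcMap X ≫ X.d 0 0) (by
    rw [Category.assoc, d_one_zero_comp_dTop, reassoc_of% lo_dTop, η_naturality, Category.assoc])

lemma cod_arr : cod X ≫ arr X = lo X ≫ X.d 1 0 := (isPullback₀ X).lift_fst _ _ _

lemma cod_src : cod X ≫ src X = srcMap X ≫ X.d 0 0 := (isPullback₀ X).lift_snd _ _ _

lemma tgtMap_d : tgtMap X ≫ X.d 0 0 = cod X ≫ tgt X := by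
  rw [tgtMap, tgt, reassoc_of% cod_arr, Category.assoc, d_one_zero_comp_d, reassoc_of% up_d_one,
    diag,
    Category.assoc]

lemma diag_d : diag X ≫ X.d 0 0 = cod X ≫ tgt X := by
  rw [diag, tgt, reassoc_of% cod_arr, Category.assoc, d_one_zero_comp_d]

lemma srcMap_dTop : srcMap X ≫ X.dTop 0 = dom X ≫ T.map (src X) := by
  -- Composing with the single unary arrow on the codomain leaves the domain unchanged.
  have h₁ : diag X ≫ X.dTop 0 = srcMap X ≫ X.dTop 0 := by
    rw [diag, Category.assoc, d_one_one_comp_dTop, reassoc_of% lo_dTop,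
      reassoc_of% η_naturality (X.dTop 0), η_μ, Category.comp_id]
  rw [← h₁, ← up_d_one, Category.assoc, d_one_one_comp_dTop, reassoc_of% up_dTop,
    ← T.map_comp_assoc,
    arr_dTop, T.map_comp, Category.assoc, η_map_μ, Category.comp_id]

lemma diag_dTop : diag X ≫ X.dTop 0 = dom X ≫ T.map (src X) := by
  rw [diag, Category.assoc, d_one_one_comp_dTop, reassoc_of% lo_dTop,
      reassoc_of% η_naturality (X.dTop 0), η_μ, Category.comp_id, srcMap_dTop]

lemma tgtMap_dTop : tgtMap X ≫ X.dTop 0 = dom X ≫ T.map (tgt X) := by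
  rw [tgtMap, Category.assoc, d_one_zero_comp_dTop, reassoc_of% up_dTop, tgt, T.map_comp]

lemma isComp_lo : X.IsComp (cod X ≫ arr X) (srcMap X ≫ T.η.app _) (diag X) :=
  ⟨lo X, (cod_arr X).symm, lo_dTop X, rfl⟩

lemma isComp_up : X.IsComp (tgtMap X) (dom X ≫ T.map (arr X)) (diag X) :=
  ⟨up X, rfl, up_dTop X, up_d_one X⟩

-- A 2-simplex is determined by its composable pair, so the four sides determine both triangles of a
-- square.
variable {X} in
lemma hom_ext₁ (hX : X.IsTCategory) {W : E} {a b : W ⟶ obj₁ X}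
    (h₁ : a ≫ srcMap X = b ≫ srcMap X) (h₂ : a ≫ cod X ≫ arr X = b ≫ cod X ≫ arr X)
    (h₃ : a ≫ tgtMap X = b ≫ tgtMap X) (h₄ : a ≫ dom X = b ≫ dom X) : a = b := by
  have e₁ : a ≫ lo X = b ≫ lo X := by
    refine (hX 0).hom_ext ?_ ?_
    · rw [Category.assoc, Category.assoc, lo_dTop, reassoc_of% h₁]
    · rwa [Category.assoc, Category.assoc, ← cod_arr]
  have e₂ : a ≫ up X = b ≫ up X := by
    refine (hX 0).hom_ext ?_ ?_
    · rw [Category.assoc, Category.assoc, up_dTop, reassoc_of% h₄]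
    · rwa [Category.assoc, Category.assoc]
  refine (isPullback₁ X).hom_ext ((isPullback_lower X).hom_ext ?_ ?_)
    ((isPullback_upper X).hom_ext ?_ ?_)
  · simpa only [lo, Category.assoc] using e₁
  · simpa only [srcMap, Category.assoc] using h₁
  · simpa only [up, Category.assoc] using e₂
  · simpa only [dom, Category.assoc] using h₄

/-- Both triangles of an identity square are degenerate, and their common diagonal is the unary
arrow itself. -/
lemma exists_idn : ∃ e : obj₀ X ⟶ obj₁ X, e ≫ lo X = arr X ≫ X.s 1 0 ∧
    e ≫ up X = arr X ≫ X.s 1 1 ∧ e ≫ srcMap X = src X ≫ X.s 0 0 ∧ e ≫ dom X = T.η.app (obj₀ X) := by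
  apply exists_lift₁
  · have h : X.s 1 0 ≫ X.dTop 1 = X.dTop 0 ≫ T.map (X.s 0 0) := X.s_comp_dTop 0 0
    rw [Category.assoc, h, reassoc_of% arr_dTop, η_naturality, Category.assoc]
  · have h : X.s 1 1 ≫ X.dTop 1 = T.η.app _ := X.s_last_comp_dTop 1
    rw [Category.assoc, h, η_naturality]
  · have h : X.s 1 0 ≫ X.d 1 1 = 𝟙 _ := X.s_comp_d_succ 1 0
    rw [Category.assoc, Category.assoc, X.s_comp_d_self 1 1, h]

/-- The identity square on a unary `1`-simplex. -/
noncomputable def idn : obj₀ X ⟶ obj₁ X := (exists_idn X).choose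

lemma idn_lo : idn X ≫ lo X = arr X ≫ X.s 1 0 := (exists_idn X).choose_spec.1

lemma idn_up : idn X ≫ up X = arr X ≫ X.s 1 1 := (exists_idn X).choose_spec.2.1

lemma idn_srcMap : idn X ≫ srcMap X = src X ≫ X.s 0 0 := (exists_idn X).choose_spec.2.2.1

lemma idn_dom : idn X ≫ dom X = T.η.app (obj₀ X) := (exists_idn X).choose_spec.2.2.2

lemma idn_tgtMap : idn X ≫ tgtMap X = tgt X ≫ X.s 0 0 := by
  have h : X.s 1 1 ≫ X.d 1 0 = X.d 0 0 ≫ X.s 0 0 := X.s_comp_d_of_lt 0 0 0 le_rfl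
  rw [tgtMap, reassoc_of% idn_up, h, tgt, Category.assoc]

lemma idn_diag : idn X ≫ diag X = arr X := by
  have h : X.s 1 0 ≫ X.d 1 1 = 𝟙 _ := X.s_comp_d_succ 1 0
  rw [diag, reassoc_of% idn_lo, h, Category.comp_id]

lemma idn_cod : idn X ≫ cod X = 𝟙 _ := by
  refine (isPullback₀ X).hom_ext ?_ ?_
  · rw [Category.assoc, cod_arr, reassoc_of% idn_lo, X.s_comp_d_self 1 0, Category.comp_id,
      Category.id_comp]
  · rw [Category.assoc, cod_src, reassoc_of% idn_srcMap, s_zero_comp_d, Category.comp_id,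
      Category.id_comp]

/-! ### Pasting of squares and its associativity -/

/-- The object of composable pairs of a square and a family of squares. -/
noncomputable def obj₂ : E := pullback (T.map (cod X)) (dom X)

/-- The family in a composable pair. -/
noncomputable def snd : obj₂ X ⟶ T.obj (obj₁ X) := pullback.fst _ _

/-- The last square in a composable pair. -/
noncomputable def fst : obj₂ X ⟶ obj₁ X := pullback.snd _ _

lemma isPullback₂ : IsPullback (snd X) (fst X) (T.map (cod X)) (dom X) :=
  IsPullback.of_hasPullback _ _

lemma fst_dom : fst X ≫ dom X = snd X ≫ T.map (cod X) := (isPullback₂ X).w.symm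

variable {X}
variable (hX : X.IsTCategory)

/-- The composite of the source sides. -/
noncomputable def srcComp : obj₂ X ⟶ X.X 2 :=
  (hX 0).lift (snd X ≫ T.map (srcMap X)) (fst X ≫ srcMap X) (by
    rw [Category.assoc, Category.assoc, srcMap_dTop, reassoc_of% fst_dom, ← T.map_comp,
      ← T.map_comp,
      cod_src])

lemma srcComp_dTop : srcComp hX ≫ X.dTop 1 = snd X ≫ T.map (srcMap X) := (hX 0).lift_fst _ _ _

lemma srcComp_d : srcComp hX ≫ X.d 1 0 = fst X ≫ srcMap X := (hX 0).lift_snd _ _ _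

/-- The composite of the target sides. -/
noncomputable def tgtComp : obj₂ X ⟶ X.X 2 :=
  (hX 0).lift (snd X ≫ T.map (tgtMap X)) (fst X ≫ tgtMap X) (by
    rw [Category.assoc, Category.assoc, tgtMap_dTop, reassoc_of% fst_dom, ← T.map_comp,
      ← T.map_comp,
      tgtMap_d])

lemma tgtComp_dTop : tgtComp hX ≫ X.dTop 1 = snd X ≫ T.map (tgtMap X) := (hX 0).lift_fst _ _ _

lemma tgtComp_d : tgtComp hX ≫ X.d 1 0 = fst X ≫ tgtMap X := (hX 0).lift_snd _ _ _

-- The triple consists of the target side of `fst`, the codomains of `snd` and the source sides of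
-- `snd`. The first two compose to the diagonal of `fst`, since the codomains of `snd` are the
-- domain of `fst`; the last two compose to the diagonals of `snd`.
include hX in
lemma isComp_upper_iff {k : obj₂ X ⟶ X.X 1} :
    X.IsComp (fst X ≫ tgtMap X) (snd X ≫ T.map (diag X)) k ↔
      X.IsComp (fst X ≫ diag X) (snd X ≫ T.map (srcMap X)) k := by
  refine IsComp.assoc_map hX (f := cod X ≫ arr X) ?_ (isComp_lo X)
  rw [T.map_comp, ← reassoc_of% fst_dom]
  exact (isComp_up X).precomp _

/-- The triple consists of the codomain of `fst`, its source side and the source sides of `snd`; the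
first two compose to the diagonal of `fst`. -/
lemma isComp_lower_iff {k : obj₂ X ⟶ X.X 1} :
    X.IsComp (fst X ≫ cod X ≫ arr X) ((srcComp hX ≫ X.d 1 1) ≫ T.η.app _) k ↔
      X.IsComp (fst X ≫ diag X) (snd X ≫ T.map (srcMap X)) k := by
  refine IsComp.assoc_unary hX (h := fst X ≫ srcMap X) ?_
    ⟨srcComp hX, srcComp_d hX, srcComp_dTop hX, rfl⟩
  rw [Category.assoc]
  exact (isComp_lo X).precomp _

/-- The triple consists of the target sides of `fst` and of `snd` and the domains of `snd`. The
upper triangles of `snd` provide the family of pairs. -/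
lemma isComp_tgt_of {k : obj₂ X ⟶ X.X 1}
    (h : X.IsComp (tgtComp hX ≫ X.d 1 1)
      ((snd X ≫ T.map (dom X) ≫ T.μ.app _) ≫ T.map (arr X)) k) :
    X.IsComp (fst X ≫ tgtMap X) (snd X ≫ T.map (diag X)) k := by
  have e : snd X ≫ T.map (diag X) = (snd X ≫ T.map (up X)) ≫ T.map (X.d 1 1) := by
    rw [← up_d_one, T.map_comp, Category.assoc]
  rw [e]
  refine IsComp.assoc_left hX (ab := tgtComp hX ≫ X.d 1 1)
    ⟨tgtComp hX, tgtComp_d hX, ?_, rfl⟩ ?_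
  · rw [tgtComp_dTop, tgtMap, T.map_comp, Category.assoc]
  · rwa [Category.assoc, ← T.map_comp_assoc, up_dTop, T.map_comp, Category.assoc, μ_naturality,
      ← Category.assoc (T.map _), ← Category.assoc]

/-- The composite square has lower triangle `a` and upper triangle `b`. Their diagonals agree
because rebracketing turns each into the diagonal of `fst` composed with the source sides of `snd`.
-/
lemma exists_comp : ∃ m : obj₂ X ⟶ obj₁ X,
    m ≫ srcMap X = srcComp hX ≫ X.d 1 1 ∧ m ≫ tgtMap X = tgtComp hX ≫ X.d 1 1 ∧
    m ≫ cod X ≫ arr X = fst X ≫ cod X ≫ arr X ∧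
    m ≫ dom X = snd X ≫ T.map (dom X) ≫ T.μ.app _ ∧
    X.IsComp (fst X ≫ diag X) (snd X ≫ T.map (srcMap X)) (m ≫ diag X) := by
  let a : obj₂ X ⟶ X.X 2 := (hX 0).lift ((srcComp hX ≫ X.d 1 1) ≫ T.η.app _)
    (fst X ≫ cod X ≫ arr X) (by
      rw [Category.assoc, η_naturality, Category.assoc, Category.assoc, Category.assoc, arr_dTop,
        reassoc_of% cod_src,
        ← reassoc_of% d_one_zero_comp_d, reassoc_of% srcComp_d])
  let b : obj₂ X ⟶ X.X 2 := (hX 0).lift ((snd X ≫ T.map (dom X) ≫ T.μ.app _) ≫ T.map (arr X))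
    (tgtComp hX ≫ X.d 1 1) (by
      rw [Category.assoc, Category.assoc _ _ (X.dTop 0), d_one_one_comp_dTop,
        reassoc_of% tgtComp_dTop,
        ← T.map_comp_assoc, tgtMap_dTop, ← T.map_comp, T.map_comp (dom X), Category.assoc,
        Category.assoc, Category.assoc, μ_naturality, tgt])
  have a₀ : a ≫ X.d 1 0 = _ := (hX 0).lift_snd _ _ _
  have a₂ : a ≫ X.dTop 1 = _ := (hX 0).lift_fst _ _ _
  have b₀ : b ≫ X.d 1 0 = _ := (hX 0).lift_snd _ _ _
  have b₂ : b ≫ X.dTop 1 = _ := (hX 0).lift_fst _ _ _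
  have ha := (isComp_lower_iff hX).1 ⟨a, a₀, a₂, rfl⟩
  have hb := (isComp_upper_iff hX).1 (isComp_tgt_of hX ⟨b, b₀, b₂, rfl⟩)
  obtain ⟨m, h₁, h₂, h₃, h₄⟩ := exists_lift₁ a b _ _ a₂ b₂ (ha.unique hX hb)
  refine ⟨m, h₃, ?_, ?_, h₄, ?_⟩
  · rw [tgtMap, reassoc_of% h₂, b₀]
  · rw [cod_arr, reassoc_of% h₁, a₀, cod_arr]
  · rwa [diag, reassoc_of% h₁]

/-- Composition of squares. -/
noncomputable def comp : obj₂ X ⟶ obj₁ X := (exists_comp hX).choose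

lemma comp_srcMap : comp hX ≫ srcMap X = srcComp hX ≫ X.d 1 1 := (exists_comp hX).choose_spec.1

lemma comp_tgtMap : comp hX ≫ tgtMap X = tgtComp hX ≫ X.d 1 1 := (exists_comp hX).choose_spec.2.1

lemma comp_cod_arr : comp hX ≫ cod X ≫ arr X = fst X ≫ cod X ≫ arr X :=
  (exists_comp hX).choose_spec.2.2.1

lemma comp_dom : comp hX ≫ dom X = snd X ≫ T.map (dom X) ≫ T.μ.app _ :=
  (exists_comp hX).choose_spec.2.2.2.1

lemma isComp_lower :
    X.IsComp (fst X ≫ diag X) (snd X ≫ T.map (srcMap X)) (comp hX ≫ diag X) :=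
  (exists_comp hX).choose_spec.2.2.2.2

lemma isComp_upper :
    X.IsComp (fst X ≫ tgtMap X) (snd X ≫ T.map (diag X)) (comp hX ≫ diag X) :=
  (isComp_upper_iff hX).2 (isComp_lower hX)

lemma isComp_src :
    X.IsComp (fst X ≫ srcMap X) (snd X ≫ T.map (srcMap X)) (comp hX ≫ srcMap X) :=
  ⟨_, srcComp_d hX, srcComp_dTop hX, (comp_srcMap hX).symm⟩

lemma isComp_tgt :
    X.IsComp (fst X ≫ tgtMap X) (snd X ≫ T.map (tgtMap X)) (comp hX ≫ tgtMap X) :=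
  ⟨_, tgtComp_d hX, tgtComp_dTop hX, (comp_tgtMap hX).symm⟩

lemma comp_cod : comp hX ≫ cod X = fst X ≫ cod X := by
  refine (isPullback₀ X).hom_ext ?_ ?_
  · rw [Category.assoc, Category.assoc, comp_cod_arr]
  · rw [Category.assoc, Category.assoc, cod_src, reassoc_of% comp_srcMap, ← reassoc_of% srcComp_d,
      d_one_zero_comp_d]

/-- Left and right unit insertions for squares. -/
lemma idn_comp_eq {r : obj₁ X ⟶ obj₂ X}
    (hf : ∀ φ : obj₁ X ⟶ X.X 1, (φ = srcMap X ∨ φ = tgtMap X) →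
      X.IsComp (r ≫ fst X ≫ φ) (r ≫ snd X ≫ T.map φ) φ)
    (hc : r ≫ fst X ≫ cod X = cod X)
    (hd : r ≫ snd X ≫ T.map (dom X) ≫ T.μ.app _ = dom X) : r ≫ comp hX = 𝟙 _ := by
  refine hom_ext₁ hX ?_ ?_ ?_ ?_
  · rw [Category.id_comp, Category.assoc]
    exact ((isComp_src hX).precomp r).unique hX (hf _ (Or.inl rfl))
  · rw [Category.id_comp, Category.assoc, comp_cod_arr, reassoc_of% hc]
  · rw [Category.id_comp, Category.assoc]
    exact ((isComp_tgt hX).precomp r).unique hX (hf _ (Or.inr rfl))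
  · rw [Category.id_comp, Category.assoc, comp_dom, hd]

/-- The lower structure maps of the power. -/
noncomputable def link₀ (X : TSimplicialObject T) : Link T (obj₁ X) (obj₀ X) where
  d _ := cod X
  t := dom X
  s _ := idn X

/-- The pair consisting of a square and identities on its domain. -/
noncomputable def insertRight (X : TSimplicialObject T) : obj₁ X ⟶ obj₂ X :=
  (isPullback₂ X).lift (dom X ≫ T.map (idn X)) (𝟙 _) (by
    rw [Category.assoc, ← T.map_comp, idn_cod, T.map_id, Category.comp_id, Category.id_comp])

/-- The pair consisting of the identity on the codomain of a square, and the square. -/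
noncomputable def insertLeft (X : TSimplicialObject T) : obj₁ X ⟶ obj₂ X :=
  (isPullback₂ X).lift (T.η.app (obj₁ X)) (cod X ≫ idn X) (by
    rw [Category.assoc, idn_dom, η_naturality])

lemma insertRight_fst : insertRight X ≫ fst X = 𝟙 _ := (isPullback₂ X).lift_snd _ _ _

lemma insertRight_snd : insertRight X ≫ snd X = dom X ≫ T.map (idn X) :=
  (isPullback₂ X).lift_fst _ _ _

lemma insertLeft_fst : insertLeft X ≫ fst X = cod X ≫ idn X := (isPullback₂ X).lift_snd _ _ _

lemma insertLeft_snd : insertLeft X ≫ snd X = T.η.app (obj₁ X) := (isPullback₂ X).lift_fst _ _ _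

lemma insertRight_comp : insertRight X ≫ comp hX = 𝟙 _ := by
  refine idn_comp_eq hX ?_ ?_ ?_
  · rintro φ (rfl | rfl)
    · rw [reassoc_of% insertRight_fst, reassoc_of% insertRight_snd, ← T.map_comp, idn_srcMap,
        T.map_comp,
        ← Category.assoc, ← srcMap_dTop, Category.assoc]
      exact IsComp.id_right _
    · rw [reassoc_of% insertRight_fst, reassoc_of% insertRight_snd, ← T.map_comp, idn_tgtMap,
        T.map_comp,
        ← Category.assoc, ← tgtMap_dTop, Category.assoc]
      exact IsComp.id_right _
  · rw [reassoc_of% insertRight_fst]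
  · rw [reassoc_of% insertRight_snd, ← T.map_comp_assoc, idn_dom, η_map_μ, Category.comp_id]

lemma insertLeft_comp : insertLeft X ≫ comp hX = 𝟙 _ := by
  refine idn_comp_eq hX ?_ ?_ ?_
  · rintro φ (rfl | rfl)
    · rw [reassoc_of% insertLeft_fst, reassoc_of% insertLeft_snd, idn_srcMap, reassoc_of% cod_src,
        η_naturality]
      exact IsComp.id_left _
    · rw [reassoc_of% insertLeft_fst, reassoc_of% insertLeft_snd, idn_tgtMap,
        ← reassoc_of% tgtMap_d, η_naturality]
      exact IsComp.id_left _
  · rw [reassoc_of% insertLeft_fst, idn_cod, Category.comp_id]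
  · rw [reassoc_of% insertLeft_snd, reassoc_of% η_naturality (dom X), η_μ, Category.comp_id]

/-- The upper structure maps of the power. -/
noncomputable def link₁ : Link T (obj₂ X) (obj₁ X) where
  d
  | 0 => fst X
  | _ + 1 => comp hX
  t := snd X
  s
  | 0 => insertRight X
  | _ + 1 => insertLeft X

lemma unital₀ : (link₀ X).Unital 0 where
  s_d_self _ _ := idn_cod X
  s_d_succ _ _ := idn_cod X
  s_t := idn_dom X

lemma unital₁ : (link₁ hX).Unital 1 where
  s_d_self j hj := by
    obtain _ | j := j
    · exact insertRight_fst
    · exact insertLeft_comp hX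
  s_d_succ j hj := by
    obtain rfl : j = 0 := by omega
    exact insertRight_comp hX
  s_t := insertLeft_snd

lemma compat : (link₁ hX).Compat (link₀ X) 0 where
  dd i j hij hj := by
    obtain rfl : j = 0 := by omega
    obtain rfl : i = 0 := by omega
    exact (comp_cod hX).symm
  dt i hi := by
    obtain rfl : i = 0 := by omega
    exact fst_dom X
  dtt := comp_dom hX
  ss i j hij hj := by
    obtain rfl : j = 0 := by omega
    obtain rfl : i = 0 := by omega
    refine (isPullback₂ X).hom_ext ?_ ?_
    · change (idn X ≫ insertLeft X) ≫ snd X = (idn X ≫ insertRight X) ≫ snd X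
      rw [Category.assoc, Category.assoc, insertLeft_snd, insertRight_snd, reassoc_of% idn_dom,
        η_naturality]
    · change (idn X ≫ insertLeft X) ≫ fst X = (idn X ≫ insertRight X) ≫ fst X
      rw [Category.assoc, Category.assoc, insertLeft_fst, insertRight_fst, reassoc_of% idn_cod,
        Category.comp_id]
  sd_lt i j hij hj := by
    obtain rfl : j = 0 := by omega
    obtain rfl : i = 0 := by omega
    exact insertLeft_fst
  sd_gt i j hij hi := by omega
  st j hj := by
    obtain rfl : j = 0 := by omega
    exact insertRight_snd

/-- It suffices to compare sides. Source and target sides associate as in `X`, with `Φ` (`srcComp`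
or `tgtComp`) supplying the family of pairs; the codomain is that of the outermost square; domains
agree by associativity of `μ`. -/
lemma nextAssoc : Link.NextAssoc (unital₁ hX) (compat hX) (isPullback₂ X) := by
  intro i j hij hj
  obtain rfl : j = 0 := by omega
  obtain rfl : i = 0 := by omega
  set N := Link.next (unital₁ hX) (compat hX) (isPullback₂ X) with hN
  have e₁ : N.d 1 ≫ fst X = N.d 0 ≫ fst X := Link.next_d_succ_d_zero _ _ _ 0 (by omega)
  have e₂ : N.d 1 ≫ snd X = N.t ≫ T.map (comp hX) := Link.next_d_t _ _ _ 1 (by omega)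
  have e₃ : N.d 2 ≫ fst X = N.d 0 ≫ comp hX := Link.next_d_succ_d_zero _ _ _ 1 (by omega)
  have e₄ : N.d 2 ≫ snd X = N.t ≫ T.map (snd X) ≫ T.μ.app _ := Link.next_d_last_t _ _ _
  have e₅ : N.t ≫ T.map (fst X) = N.d 0 ≫ snd X := Link.next_w _ _ _
  have key (φ : obj₁ X ⟶ X.X 1) (Φ : obj₂ X ⟶ X.X 2) (h₀ : Φ ≫ X.d 1 0 = fst X ≫ φ)
      (h₁ : comp hX ≫ φ = Φ ≫ X.d 1 1) (h₂ : Φ ≫ X.dTop 1 = snd X ≫ T.map φ) :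
      N.d 1 ≫ comp hX ≫ φ = N.d 2 ≫ comp hX ≫ φ := by
    have hφ : X.IsComp (fst X ≫ φ) (snd X ≫ T.map φ) (comp hX ≫ φ) := ⟨Φ, h₀, h₂, h₁.symm⟩
    refine (hφ.precomp (N.d 1)).unique hX ?_
    have := IsComp.assoc_left hX (g := N.d 0 ≫ fst X ≫ φ) (b := N.t ≫ T.map Φ)
      (ab := N.d 0 ≫ comp hX ≫ φ) (k := N.d 2 ≫ comp hX ≫ φ) ?_ ?_
    · rwa [Category.assoc, ← T.map_comp, ← h₁, T.map_comp, ← reassoc_of% e₁,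
        ← reassoc_of% e₂] at this
    · rw [Category.assoc, ← T.map_comp, h₀, T.map_comp, reassoc_of% e₅]
      exact hφ.precomp _
    · rw [Category.assoc, ← T.map_comp_assoc, h₂, T.map_comp, Category.assoc, μ_naturality,
        ← reassoc_of% e₄, ← reassoc_of% e₃]
      exact hφ.precomp _
  change N.d 1 ≫ comp hX = N.d 2 ≫ comp hX
  refine hom_ext₁ hX ?_ ?_ ?_ ?_
  · rw [Category.assoc, Category.assoc]
    exact key _ _ (srcComp_d hX) (comp_srcMap hX) (srcComp_dTop hX)
  · rw [Category.assoc, Category.assoc, comp_cod_arr, reassoc_of% e₁, reassoc_of% e₃,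
      comp_cod_arr]
  · rw [Category.assoc, Category.assoc]
    exact key _ _ (tgtComp_d hX) (comp_tgtMap hX) (tgtComp_dTop hX)
  · rw [Category.assoc, Category.assoc, comp_dom, reassoc_of% e₂, reassoc_of% e₄,
      ← T.map_comp_assoc, comp_dom, ← reassoc_of% μ_naturality (dom X)]
    simp only [T.map_comp, Category.assoc, T.assoc]

/-- The lowest levels of the power. -/
noncomputable def stage : Stage T 0 where
  X := obj₀ X
  Y := obj₁ X
  Z := obj₂ X
  l := link₀ X
  k := link₁ hX
  unital_l := unital₀
  unital_k := unital₁ hX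
  compat := compat hX
  isSegal := isPullback₂ X
  assoc := nextAssoc hX

end Power

/-- The power of a `T`-category by the `1`-simplex. -/
noncomputable def power {X : TSimplicialObject T} (hX : X.IsTCategory) : TSimplicialObject T :=
  (Power.stage hX).nerve

lemma power_isTCategory {X : TSimplicialObject T} (hX : X.IsTCategory) :
    (power hX).IsTCategory :=
  Stage.nerve_isTCategory _

end TSimplicialObject

/-! ### The universal cylinder -/

namespace TSimplicialObject

variable {E : Type u} [Category.{v} E] {T : Monad E} {X Y Z : TSimplicialObject T}

namespace Fam

/-- Composition of families. -/
def comp {P Q : SSet.{w}} (a : Fam P Z Y) (b : Fam Q Y X) : Fam (Q ⊗ P) Z X where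
  z p := a.z p.2 ≫ b.z p.1
  d_comm p i := by
    rw [Category.assoc, b.d_comm, reassoc_of% a.d_comm]
    rfl
  dTop_comm p := by
    rw [Category.assoc, b.dTop_comm, reassoc_of% a.dTop_comm, ← T.map_comp]
    rfl
  s_comm p i := by
    rw [Category.assoc, b.s_comm, reassoc_of% a.s_comm]
    rfl

end Fam

namespace Power

open SSet.stdSimplex

/-- The number of zeros of a simplex of `Δ[1]`. -/
noncomputable def zeros {n : ℕ} (α : (Δ[1] : SSet.{w}) _⦋n⦌) : Fin (n + 2) :=
  (Equiv.ofBijective _ objMk₁_bijective).symm α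

lemma zeros_objMk₁ {n : ℕ} (c : Fin (n + 2)) : zeros (objMk₁.{w} c) = c :=
  (Equiv.ofBijective _ objMk₁_bijective).symm_apply_apply c

/-- Deleting a vertex over 1 keeps the number of zeros. Passing the new count `c'` with an equation
lets `decide` settle concrete cases. -/
lemma zeros_δ_of_le {n : ℕ} (c : Fin (n + 3)) (j : Fin (n + 2)) (c' : Fin (n + 2))
    (h : c ≤ j.castSucc) (hc : c = c'.castSucc) :
    (Δ[1] : SSet.{w}).δ j (objMk₁ c) = objMk₁ c' := by
  subst hc
  rw [δ_objMk₁_of_le _ _ h, Fin.castPred_castSucc]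

lemma zeros_δ_of_lt {n : ℕ} (c : Fin (n + 3)) (j : Fin (n + 2)) (c' : Fin (n + 2))
    (h : j.castSucc < c) (hc : c = c'.succ) :
    (Δ[1] : SSet.{w}).δ j (objMk₁ c) = objMk₁ c' := by
  subst hc
  rw [δ_objMk₁_of_lt _ _ h, Fin.pred_succ]

lemma zeros_σ_of_le {n : ℕ} (c : Fin (n + 2)) (j : Fin (n + 1)) (c' : Fin (n + 3))
    (h : c ≤ j.castSucc) (hc : c' = c.castSucc) :
    (Δ[1] : SSet.{w}).σ j (objMk₁ c) = objMk₁ c' := by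
  subst hc
  exact σ_objMk₁_of_le _ _ h

lemma zeros_σ_of_lt {n : ℕ} (c : Fin (n + 2)) (j : Fin (n + 1)) (c' : Fin (n + 3))
    (h : j.castSucc < c) (hc : c' = c.succ) :
    (Δ[1] : SSet.{w}).σ j (objMk₁ c) = objMk₁ c' := by
  subst hc
  exact σ_objMk₁_of_lt _ _ h

section

variable {P : SSet.{w}}

/-- A component of a family indexed by a cylinder. -/
def cylZ (f : Fam (Δ[1] ⊗ P) Y X) {m : ℕ} (c : Fin (m + 2)) (p : P _⦋m⦌) :
    Y.X m ⟶ X.X m :=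
  f.z ((objMk₁ c, p) : (Δ[1] ⊗ P : SSet.{w}) _⦋m⦌)

variable (f : Fam (Δ[1] ⊗ P) Y X)

lemma cylZ_congr {m : ℕ} {α : (Δ[1] : SSet.{w}) _⦋m⦌} {c : Fin (m + 2)} (h : α = objMk₁ c)
    (p : P _⦋m⦌) : f.z ((α, p) : (Δ[1] ⊗ P : SSet.{w}) _⦋m⦌) = cylZ f c p := by
  subst h
  rfl

lemma cylZ_d_of_le {m : ℕ} (c : Fin (m + 3)) (c' : Fin (m + 2)) (i : Fin (m + 1)) (p : P _⦋m + 1⦌)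
    (h : c ≤ i.castSucc.castSucc) (hc : c = c'.castSucc) :
    cylZ f c p ≫ X.d m i = Y.d m i ≫ cylZ f c' (P.δ i.castSucc p) :=
  (f.d_comm _ i).trans (congrArg (Y.d m i ≫ ·) (cylZ_congr f (zeros_δ_of_le c _ c' h hc) _))

lemma cylZ_d_of_lt {m : ℕ} (c : Fin (m + 3)) (c' : Fin (m + 2)) (i : Fin (m + 1)) (p : P _⦋m + 1⦌)
    (h : i.castSucc.castSucc < c) (hc : c = c'.succ) :
    cylZ f c p ≫ X.d m i = Y.d m i ≫ cylZ f c' (P.δ i.castSucc p) :=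
  (f.d_comm _ i).trans (congrArg (Y.d m i ≫ ·) (cylZ_congr f (zeros_δ_of_lt c _ c' h hc) _))

lemma cylZ_dTop_of_le {m : ℕ} (c : Fin (m + 3)) (c' : Fin (m + 2)) (p : P _⦋m + 1⦌)
    (hc : c = c'.castSucc) :
    cylZ f c p ≫ X.dTop m = Y.dTop m ≫ T.map (cylZ f c' (P.δ (Fin.last (m + 1)) p)) :=
  (f.dTop_comm _).trans (congrArg (fun g => Y.dTop m ≫ T.map g)
    (cylZ_congr f (zeros_δ_of_le c _ c' (by simpa [hc] using Fin.le_last c') hc) _))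

lemma cylZ_s_of_le {m : ℕ} (c : Fin (m + 2)) (c' : Fin (m + 3)) (i : Fin (m + 1)) (p : P _⦋m⦌)
    (h : c ≤ i.castSucc) (hc : c' = c.castSucc) :
    cylZ f c p ≫ X.s m i = Y.s m i ≫ cylZ f c' (P.σ i p) :=
  (f.s_comm _ i).trans (congrArg (Y.s m i ≫ ·) (cylZ_congr f (zeros_σ_of_le c _ c' h hc) _))

lemma cylZ_s_of_lt {m : ℕ} (c : Fin (m + 2)) (c' : Fin (m + 3)) (i : Fin (m + 1)) (p : P _⦋m⦌)
    (h : i.castSucc < c) (hc : c' = c.succ) :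
    cylZ f c p ≫ X.s m i = Y.s m i ≫ cylZ f c' (P.σ i p) :=
  (f.s_comm _ i).trans (congrArg (Y.s m i ≫ ·) (cylZ_congr f (zeros_σ_of_lt c _ c' h hc) _))

lemma isComp_cylZ (c : Fin 4) (c₀ c₁ c₂ : Fin 3)
    (h₀ : Δ[1].δ 0 (objMk₁.{w} c) = objMk₁ c₀) (h₁ : Δ[1].δ 1 (objMk₁.{w} c) = objMk₁ c₁)
    (h₂ : Δ[1].δ 2 (objMk₁.{w} c) = objMk₁ c₂) (p : P _⦋2⦌) :
    X.IsComp (Y.d 1 0 ≫ cylZ f c₀ (P.δ 0 p)) (Y.dTop 1 ≫ T.map (cylZ f c₂ (P.δ 2 p)))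
      (Y.d 1 1 ≫ cylZ f c₁ (P.δ 1 p)) := by
  rw [← cylZ_congr f h₀, ← cylZ_congr f h₁, ← cylZ_congr f h₂]
  exact f.isComp ((objMk₁ c, p) : (Δ[1] ⊗ P : SSet.{w}) _⦋2⦌)

end

variable [HasPullbacks E]

section Cylinder

variable (hX : X.IsTCategory)

/-- The vertices of the universal cylinder, by the number of zeros. -/
noncomputable def vertex (X : TSimplicialObject T) (c : Fin 2) : obj₀ X ⟶ X.X 0 :=
  ![tgt X, src X] c

/-- The edges of the universal cylinder, by the number of zeros. -/
noncomputable def edge (X : TSimplicialObject T) (c : Fin 3) : obj₁ X ⟶ X.X 1 :=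
  ![tgtMap X, diag X, srcMap X] c

/-- The lowest levels of the universal cylinder. -/
noncomputable def cylinderLevel :
    Fam.Level (Δ[1] : SSet.{w}) (power hX) X 0 where
  a α := vertex X (zeros α)
  b α := edge X (zeros α)
  d_zero α := by
    obtain ⟨c, rfl⟩ := objMk₁_surjective α
    rw [zeros_objMk₁]
    fin_cases c
    · rw [zeros_δ_of_le _ _ 0 (by decide) (by decide), zeros_objMk₁]
      exact tgtMap_d X
    · rw [zeros_δ_of_lt _ _ 0 (by decide) (by decide), zeros_objMk₁]
      exact diag_d X
    · rw [zeros_δ_of_lt _ _ 1 (by decide) (by decide), zeros_objMk₁]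
      exact (cod_src X).symm
  dTop α := by
    obtain ⟨c, rfl⟩ := objMk₁_surjective α
    rw [zeros_objMk₁]
    fin_cases c
    · rw [zeros_δ_of_le _ _ 0 (by decide) (by decide), zeros_objMk₁]
      exact tgtMap_dTop X
    · rw [zeros_δ_of_le _ _ 1 (by decide) (by decide), zeros_objMk₁]
      exact diag_dTop X
    · rw [zeros_δ_of_lt _ _ 1 (by decide) (by decide), zeros_objMk₁]
      exact srcMap_dTop X

/-- The universal cylinder of the power of `X` by the `1`-simplex. -/
noncomputable def cylinder : Fam (Δ[1] : SSet.{w}) (power hX) X :=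
  Fam.extend hX (cylinderLevel hX)
    (fun α => by
      obtain ⟨c, rfl⟩ := objMk₁_surjective α
      simp only [cylinderLevel]
      rw [zeros_objMk₁]
      fin_cases c
      · rw [zeros_σ_of_le _ _ 0 (by decide) (by decide), zeros_objMk₁]
        exact (idn_tgtMap X).symm
      · rw [zeros_σ_of_lt _ _ 2 (by decide) (by decide), zeros_objMk₁]
        exact (idn_srcMap X).symm)
    -- With 0 or 3 zeros these are the composites of target or source sides; with 1 or 2 zeros, the
    -- two factorizations of the diagonal of a composite square.
    (fun α => by
      obtain ⟨c, rfl⟩ := objMk₁_surjective α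
      simp only [cylinderLevel]
      fin_cases c
      · rw [zeros_δ_of_le _ 0 0 (by decide) (by decide),
          zeros_δ_of_le _ 1 0 (by decide) (by decide),
          zeros_δ_of_le _ 2 0 (by decide) (by decide), zeros_objMk₁]
        exact isComp_tgt hX
      · rw [zeros_δ_of_lt _ 0 0 (by decide) (by decide),
          zeros_δ_of_le _ 1 1 (by decide) (by decide),
          zeros_δ_of_le _ 2 1 (by decide) (by decide), zeros_objMk₁, zeros_objMk₁]
        exact isComp_upper hX
      · rw [zeros_δ_of_lt _ 0 1 (by decide) (by decide),
          zeros_δ_of_lt _ 1 1 (by decide) (by decide),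
          zeros_δ_of_le _ 2 2 (by decide) (by decide), zeros_objMk₁, zeros_objMk₁]
        exact isComp_lower hX
      · rw [zeros_δ_of_lt _ 0 2 (by decide) (by decide),
          zeros_δ_of_lt _ 1 2 (by decide) (by decide),
          zeros_δ_of_lt _ 2 2 (by decide) (by decide), zeros_objMk₁]
        exact isComp_src hX)

lemma cylinder_zero (c : Fin 2) :
    (cylinder hX).z (objMk₁.{w} c : Δ[1] _⦋0⦌) = vertex X c :=
  congrArg (vertex X) (zeros_objMk₁ c)

lemma cylinder_one (c : Fin 3) :
    (cylinder hX).z (objMk₁.{w} c : Δ[1] _⦋1⦌) = edge X c :=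
  congrArg (edge X) (zeros_objMk₁ c)

end Cylinder

/-! ### The universal property of the cylinder -/

section Universal

variable {hX : X.IsTCategory} {P : SSet.{w}}

/-- The value of a family in the power on a vertex. -/
def low (f : Fam P Y (power hX)) (p : P _⦋0⦌) : Y.X 0 ⟶ obj₀ X := f.z p

/-- The value of a family in the power on an edge. -/
def high (f : Fam P Y (power hX)) (p : P _⦋1⦌) : Y.X 1 ⟶ obj₁ X := f.z p

lemma low_idn (f : Fam P Y (power hX)) (p : P _⦋0⦌) :
    low f p ≫ idn X = Y.s 0 0 ≫ high f (P.σ 0 p) := f.s_comm p 0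

lemma high_cod (f : Fam P Y (power hX)) (p : P _⦋1⦌) :
    high f p ≫ cod X = Y.d 0 0 ≫ low f (P.δ 0 p) := f.d_comm p 0

lemma high_dom (f : Fam P Y (power hX)) (p : P _⦋1⦌) :
    high f p ≫ dom X = Y.dTop 0 ≫ T.map (low f (P.δ 1 p)) := f.dTop_comm p

lemma comp_cylinder_zero (f : Fam P Y (power hX)) (c : Fin 2) (p : P _⦋0⦌) :
    (f.comp (cylinder hX)).z ((objMk₁ c, p) : (Δ[1] ⊗ P : SSet.{w}) _⦋0⦌) =
      low f p ≫ vertex X c :=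
  congrArg (f.z p ≫ ·) (cylinder_zero.{w} hX c)

lemma comp_cylinder_one (f : Fam P Y (power hX)) (c : Fin 3) (p : P _⦋1⦌) :
    (f.comp (cylinder hX)).z ((objMk₁ c, p) : (Δ[1] ⊗ P : SSet.{w}) _⦋1⦌) =
      high f p ≫ edge X c :=
  congrArg (f.z p ≫ ·) (cylinder_one.{w} hX c)

lemma comp_cylinder_injective {a b : Fam P Y (power hX)}
    (h : a.comp (cylinder.{w} hX) = b.comp (cylinder hX)) : a = b := by
  have h₀ (p : P _⦋0⦌) (c : Fin 2) : low a p ≫ vertex X c = low b p ≫ vertex X c := by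
    rw [← comp_cylinder_zero, h, comp_cylinder_zero]
  have h₁ (p : P _⦋1⦌) (c : Fin 3) : high a p ≫ edge X c = high b p ≫ edge X c := by
    rw [← comp_cylinder_one, h, comp_cylinder_one]
  -- The unary arrow at a vertex is visible through the cylinder as the diagonal over the degenerate
  -- edge.
  have harr (f : Fam P Y (power hX)) (p : P _⦋0⦌) :
      low f p ≫ arr X = Y.s 0 0 ≫ high f (P.σ 0 p) ≫ edge X 1 := by
    have h₃ : idn X ≫ edge X 1 = arr X := idn_diag X
    rw [← h₃, reassoc_of% low_idn]
  have h₂ (p : P _⦋0⦌) : low a p = low b p := by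
    refine (isPullback₀ X).hom_ext ?_ (h₀ p 1)
    rw [harr, harr, h₁]
  refine Fam.ext_one (power_isTCategory hX) fun p => ?_
  refine hom_ext₁ hX (a := high a p) (b := high b p) (h₁ p 2) ?_ (h₁ p 0) ?_
  · rw [reassoc_of% high_cod, reassoc_of% high_cod, h₂]
  · rw [high_dom, high_dom, h₂]

variable (f : Fam (Δ[1] ⊗ P) Y X)

/-- The unary `1`-simplices determined by a family indexed by a cylinder. -/
noncomputable def transposeLow (p : P _⦋0⦌) : Y.X 0 ⟶ obj₀ X :=
  (isPullback₀ X).lift (Y.s 0 0 ≫ cylZ f 1 (P.σ 0 p)) (cylZ f 1 p) (by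
    rw [Category.assoc, cylZ_dTop_of_le f 1 1 _ (by decide), reassoc_of% s_zero_comp_dTop,
      η_naturality]
    have h := P.δ_comp_σ_succ_apply (0 : Fin 1) p
    dsimp at h ⊢
    rw [h])

lemma transposeLow_arr (p : P _⦋0⦌) :
    transposeLow f p ≫ arr X = Y.s 0 0 ≫ cylZ f 1 (P.σ 0 p) := (isPullback₀ X).lift_fst _ _ _

lemma transposeLow_src (p : P _⦋0⦌) : transposeLow f p ≫ src X = cylZ f 1 p :=
  (isPullback₀ X).lift_snd _ _ _

lemma transposeLow_tgt (p : P _⦋0⦌) : transposeLow f p ≫ tgt X = cylZ f 0 p := by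
  rw [tgt, reassoc_of% transposeLow_arr, cylZ_d_of_lt f 1 0 0 _ (by decide) (by decide),
    reassoc_of% s_zero_comp_d]
  have h := P.δ_comp_σ_self_apply (0 : Fin 1) p
  dsimp at h ⊢
  rw [h]

/-- The prism over `p` consists of the 2-simplices `(2, σ_1 p)` and `(1, σ_0 p)`, the first entry
counting zeros. Evaluating them on degenerate 2-simplices of `Y` gives the lower and upper triangles
of a square. -/
lemma exists_transposeHigh (p : P _⦋1⦌) : ∃ g : Y.X 1 ⟶ obj₁ X,
    g ≫ lo X = Y.s 1 1 ≫ cylZ f 2 (P.σ 1 p) ∧ g ≫ up X = Y.s 1 0 ≫ cylZ f 1 (P.σ 0 p) ∧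
    g ≫ srcMap X = cylZ f 2 p ∧ g ≫ dom X = Y.dTop 0 ≫ T.map (transposeLow f (P.δ 1 p)) := by
  have h₁ : Y.s 1 1 ≫ Y.dTop 1 = T.η.app _ := Y.s_last_comp_dTop 1
  have h₂ : Y.s 1 0 ≫ Y.dTop 1 = Y.dTop 0 ≫ T.map (Y.s 0 0) := Y.s_comp_dTop 0 0
  have h₃ : Y.s 1 0 ≫ Y.d 1 1 = 𝟙 _ := Y.s_comp_d_succ 1 0
  apply exists_lift₁
  · have h := P.δ_comp_σ_succ_apply (1 : Fin 2) p
    rw [Category.assoc, cylZ_dTop_of_le f 2 2 _ (by decide), reassoc_of% h₁, η_naturality]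
    congr 2
  · have h := P.δ_comp_σ_of_gt_apply (i := (1 : Fin 2)) (j := (0 : Fin 1)) (by decide) p
    rw [Category.assoc, cylZ_dTop_of_le f 1 1 _ (by decide), reassoc_of% h₂, Category.assoc,
      ← T.map_comp, ← T.map_comp, transposeLow_arr]
    congr 4
  · have h := P.δ_comp_σ_self_apply (1 : Fin 2) p
    have h' := P.δ_comp_σ_succ_apply (0 : Fin 2) p
    rw [Category.assoc, Category.assoc, cylZ_d_of_lt f 2 1 1 _ (by decide) (by decide),
      cylZ_d_of_le f 1 1 1 _ (by decide) (by decide), reassoc_of% Y.s_comp_d_self 1 1,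
      reassoc_of% h₃]
    exact congrArg (cylZ f 1) (h.trans h'.symm)

/-- The squares determined by a family indexed by a cylinder. -/
noncomputable def transposeHigh (p : P _⦋1⦌) : Y.X 1 ⟶ obj₁ X := (exists_transposeHigh f p).choose

lemma transposeHigh_lo (p : P _⦋1⦌) :
    transposeHigh f p ≫ lo X = Y.s 1 1 ≫ cylZ f 2 (P.σ 1 p) :=
  (exists_transposeHigh f p).choose_spec.1

lemma transposeHigh_up (p : P _⦋1⦌) :
    transposeHigh f p ≫ up X = Y.s 1 0 ≫ cylZ f 1 (P.σ 0 p) :=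
  (exists_transposeHigh f p).choose_spec.2.1

lemma transposeHigh_srcMap (p : P _⦋1⦌) : transposeHigh f p ≫ srcMap X = cylZ f 2 p :=
  (exists_transposeHigh f p).choose_spec.2.2.1

lemma transposeHigh_dom (p : P _⦋1⦌) :
    transposeHigh f p ≫ dom X = Y.dTop 0 ≫ T.map (transposeLow f (P.δ 1 p)) :=
  (exists_transposeHigh f p).choose_spec.2.2.2

lemma transposeHigh_tgtMap (p : P _⦋1⦌) : transposeHigh f p ≫ tgtMap X = cylZ f 0 p := by
  have h := P.δ_comp_σ_self_apply (0 : Fin 2) p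
  rw [tgtMap, reassoc_of% transposeHigh_up, cylZ_d_of_lt f 1 0 0 _ (by decide) (by decide),
    reassoc_of% Y.s_comp_d_self 1 0]
  exact congrArg (cylZ f 0) h

lemma transposeHigh_diag (p : P _⦋1⦌) : transposeHigh f p ≫ diag X = cylZ f 1 p := by
  have h := P.δ_comp_σ_self_apply (1 : Fin 2) p
  rw [diag, reassoc_of% transposeHigh_lo, cylZ_d_of_lt f 2 1 1 _ (by decide) (by decide),
    reassoc_of% Y.s_comp_d_self 1 1]
  exact congrArg (cylZ f 1) h

lemma transposeHigh_cod (p : P _⦋1⦌) :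
    transposeHigh f p ≫ cod X = Y.d 0 0 ≫ transposeLow f (P.δ 0 p) := by
  refine (isPullback₀ X).hom_ext ?_ ?_
  · have h := P.δ_comp_σ_of_le_apply (i := (0 : Fin 2)) (j := (0 : Fin 1)) (by decide) p
    have h' : Y.s 1 1 ≫ Y.d 1 0 = Y.d 0 0 ≫ Y.s 0 0 := Y.s_comp_d_of_lt 0 0 0 le_rfl
    rw [Category.assoc, Category.assoc, cod_arr, reassoc_of% transposeHigh_lo,
      cylZ_d_of_lt f 2 1 0 _ (by decide) (by decide), reassoc_of% h', transposeLow_arr]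
    congr 3
  · rw [Category.assoc, Category.assoc, cod_src, transposeLow_src,
      reassoc_of% transposeHigh_srcMap, cylZ_d_of_lt f 2 1 0 _ (by decide) (by decide)]
    rfl

variable (hX)

/-- The lowest levels of the family in the power determined by a family indexed by a cylinder. -/
noncomputable def transposeLevel : Fam.Level P Y (power hX) 0 where
  a := transposeLow f
  b := transposeHigh f
  d_zero := transposeHigh_cod f
  dTop := transposeHigh_dom f

include hX in
lemma transposeLow_idn (p : P _⦋0⦌) :
    transposeLow f p ≫ idn X = Y.s 0 0 ≫ transposeHigh f (P.σ 0 p) := by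
  refine hom_ext₁ hX ?_ ?_ ?_ ?_
  · rw [Category.assoc, Category.assoc, idn_srcMap, reassoc_of% transposeLow_src,
      transposeHigh_srcMap,
      cylZ_s_of_lt f 1 2 0 _ (by decide) (by decide)]
  · rw [Category.assoc, Category.assoc, reassoc_of% idn_cod, reassoc_of% transposeHigh_cod,
      reassoc_of% s_zero_comp_d]
    exact congrArg (transposeLow f · ≫ arr X) (P.δ_comp_σ_self_apply (0 : Fin 1) p).symm
  · rw [Category.assoc, Category.assoc, idn_tgtMap, reassoc_of% transposeLow_tgt,
      transposeHigh_tgtMap,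
      cylZ_s_of_le f 0 0 0 _ (by decide) (by decide)]
  · rw [Category.assoc, Category.assoc, idn_dom, transposeHigh_dom, reassoc_of% s_zero_comp_dTop,
      η_naturality]
    exact congrArg (transposeLow f · ≫ T.η.app (obj₀ X))
      (P.δ_comp_σ_succ_apply (0 : Fin 1) p).symm

/-- Again sides suffice: source and target follow from `f` on the constant simplices of `Δ[1]` (3 or
0 zeros), codomain and domain from face identities in `P` and `Y`. -/
lemma isComp_transposeHigh (p : P _⦋2⦌) :
    (power hX).IsComp (Y.d 1 0 ≫ transposeHigh f (P.δ 0 p))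
      (Y.dTop 1 ≫ T.map (transposeHigh f (P.δ 2 p))) (Y.d 1 1 ≫ transposeHigh f (P.δ 1 p)) := by
  have e₀₂ : P.δ 0 (P.δ 2 p) = P.δ 1 (P.δ 0 p) :=
    P.δ_comp_δ_apply (i := (0 : Fin 2)) (j := 1) (by decide) p
  have e₀₁ : P.δ 0 (P.δ 1 p) = P.δ 0 (P.δ 0 p) :=
    P.δ_comp_δ_apply (i := (0 : Fin 2)) (j := 0) (by decide) p
  have e₁₂ : P.δ 1 (P.δ 2 p) = P.δ 1 (P.δ 1 p) :=
    P.δ_comp_δ_apply (i := (1 : Fin 2)) (j := 1) (by decide) p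
  have w : (Y.dTop 1 ≫ T.map (transposeHigh f (P.δ 2 p))) ≫ T.map (cod X) =
      (Y.d 1 0 ≫ transposeHigh f (P.δ 0 p)) ≫ dom X := by
    rw [Category.assoc, Category.assoc, ← T.map_comp, transposeHigh_cod, transposeHigh_dom, e₀₂,
      reassoc_of% d_one_zero_comp_dTop (X := Y), T.map_comp]
  let S : Y.X 2 ⟶ obj₂ X := (isPullback₂ X).lift _ _ w
  have S₀ : S ≫ fst X = Y.d 1 0 ≫ transposeHigh f (P.δ 0 p) := (isPullback₂ X).lift_snd _ _ _
  have S₂ : S ≫ snd X = Y.dTop 1 ≫ T.map (transposeHigh f (P.δ 2 p)) :=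
    (isPullback₂ X).lift_fst _ _ _
  refine ⟨S, S₀, S₂, ?_⟩
  suffices h : (S ≫ comp hX : Y.X 2 ⟶ obj₁ X) = Y.d 1 1 ≫ transposeHigh f (P.δ 1 p) from h
  refine hom_ext₁ hX ?_ ?_ ?_ ?_
  · rw [Category.assoc, Category.assoc, transposeHigh_srcMap]
    refine ((isComp_src hX).precomp S).unique hX ?_
    rw [reassoc_of% S₀, reassoc_of% S₂, transposeHigh_srcMap, ← T.map_comp, transposeHigh_srcMap]
    exact isComp_cylZ f 3 2 2 2 (zeros_δ_of_lt _ _ _ (by decide) (by decide))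
      (zeros_δ_of_lt _ _ _ (by decide) (by decide)) (zeros_δ_of_lt _ _ _ (by decide) (by decide)) p
  · rw [Category.assoc, comp_cod_arr, reassoc_of% S₀, reassoc_of% transposeHigh_cod, Category.assoc,
      reassoc_of% transposeHigh_cod, reassoc_of% d_one_zero_comp_d (X := Y), e₀₁]
  · rw [Category.assoc, Category.assoc, transposeHigh_tgtMap]
    refine ((isComp_tgt hX).precomp S).unique hX ?_
    rw [reassoc_of% S₀, reassoc_of% S₂, transposeHigh_tgtMap, ← T.map_comp, transposeHigh_tgtMap]
    exact isComp_cylZ f 0 0 0 0 (zeros_δ_of_le _ _ _ (by decide) (by decide))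
      (zeros_δ_of_le _ _ _ (by decide) (by decide)) (zeros_δ_of_le _ _ _ (by decide) (by decide)) p
  · rw [Category.assoc, comp_dom, reassoc_of% S₂, Category.assoc, transposeHigh_dom,
      reassoc_of% d_one_one_comp_dTop (X := Y), ← T.map_comp_assoc, transposeHigh_dom, e₁₂,
      T.map_comp, Category.assoc, μ_naturality]

/-- The family in the power determined by a family indexed by a cylinder. -/
noncomputable def transpose : Fam P Y (power hX) :=
  Fam.extend (power_isTCategory hX) (transposeLevel hX f) (transposeLow_idn hX f)
    (isComp_transposeHigh hX f)

lemma transpose_comp_cylinder (hX : X.IsTCategory) : (transpose hX f).comp (cylinder hX) = f := by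
  refine Fam.ext_one hX ?_
  rintro ⟨α, p⟩
  obtain ⟨c, rfl⟩ := objMk₁_surjective α
  refine (comp_cylinder_one _ c p).trans ?_
  fin_cases c
  · exact transposeHigh_tgtMap f p
  · exact transposeHigh_diag f p
  · exact transposeHigh_srcMap f p

lemma comp_cylinder_bijective :
    Function.Bijective (fun a : Fam P Y (power hX) => a.comp (cylinder.{w} hX)) :=
  ⟨fun _ _ h => comp_cylinder_injective h, fun f => ⟨transpose hX f, transpose_comp_cylinder f hX⟩⟩

end Universal

end Power

end TSimplicialObject

/-! ### Powers in terms of generalized elements -/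

section PowerCriterion

variable {V : Type w} [Category.{w'} V] [MonoidalCategory V] [BraidedCategory V]
  {C : Type u} [EnrichedCategory V C]

/-- The map `A ⊗ W ⟶ C(Y, X)` induced by `g : W ⟶ C(Y, L)` and a cylinder `κ : A ⟶ C(L, X)`. -/
def cylinderComp {A : V} {X L : C} (κ : A ⟶ (L ⟶[V] X)) (Y : C) {W : V} (g : W ⟶ (Y ⟶[V] L)) :
    A ⊗ W ⟶ (Y ⟶[V] X) :=
  A ◁ g ≫ (β_ A (Y ⟶[V] L)).hom ≫ (Y ⟶[V] L) ◁ κ ≫ eComp V Y L X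

/-- By Yoneda, invertibility can be tested on maps out of every `W`, and transposing removes the
internal hom. -/
lemma isPower_iff [MonoidalClosed V] {A : V} {X L : C} {κ : A ⟶ (L ⟶[V] X)} :
    IsPower A X L κ ↔
      ∀ (Y : C) (W : V), Function.Bijective (fun g : W ⟶ (Y ⟶[V] L) => cylinderComp κ Y g) := by
  have h (Y : C) (W : V) : (fun g : W ⟶ (Y ⟶[V] L) => cylinderComp κ Y g) =
      MonoidalClosed.uncurry ∘ fun g => g ≫ powerComparison A κ Y := by
    funext g
    apply MonoidalClosed.curry_injective
    rw [Function.comp_apply, MonoidalClosed.curry_uncurry, powerComparison,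
      ← MonoidalClosed.curry_natural_left]
    rfl
  have h' (W B : V) : Function.Bijective (MonoidalClosed.uncurry (A := A) (Y := W) (X := B)) :=
    ((ihom.adjunction A).homEquiv _ _).symm.bijective
  refine forall_congr' fun Y => ?_
  rw [isIso_iff_yoneda_map_bijective]
  refine forall_congr' fun W => ?_
  rw [h]
  exact ((h' _ _).of_comp_iff' _).symm

end PowerCriterion

/-! ### Families as maps to hom simplicial sets; uniqueness of powers -/

namespace TSimplicialObject

variable {E : Type u} [Category.{v} E] {T : Monad E} {X Y Z : TSimplicialObject T}

namespace Fam

variable {P Q : SSet.{v}}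

/-- The value at a simplex of a map to the hom simplicial set. -/
def value (g : P ⟶ sHom Y X) {m : ℕ} (p : P _⦋m⦌) : HomSimplex Y X ⦋m⦌ := g.app (op ⦋m⦌) p

lemma value_map (g : P ⟶ sHom Y X) {m k : ℕ} (φ : ⦋k⦌ ⟶ ⦋m⦌) (p : P _⦋m⦌) :
    value g (P.map φ.op p : P _⦋k⦌) = (value g p).pullback φ :=
  NatTrans.naturality_apply g φ.op p

lemma value_map_app (g : P ⟶ sHom Y X) {m k : ℕ} (φ : ⦋k⦌ ⟶ ⦋m⦌) (p : P _⦋m⦌) :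
    (value g (P.map φ.op p : P _⦋k⦌)).app (𝟙 ⦋k⦌) = (value g p).app φ := by
  rw [value_map, HomSimplex.pullback_app, Category.id_comp]

/-- The family given by a map to the hom simplicial set. -/
def ofMap (g : P ⟶ sHom Y X) : Fam P Y X where
  z {m} p := (value g p).app (𝟙 ⦋m⦌)
  d_comm {m} p i := by
    have h := value_map_app g (SimplexCategory.δ i.castSucc) p
    rw [HomSimplex.d_comm, Category.comp_id, ← h]
    rfl
  dTop_comm {m} p := by
    have h := value_map_app g (SimplexCategory.δ (Fin.last (m + 1))) p
    rw [HomSimplex.dTop_comm, Category.comp_id, ← h]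
    rfl
  s_comm {m} p i := by
    have h := value_map_app g (SimplexCategory.σ i) p
    rw [HomSimplex.s_comm, Category.comp_id, ← h]
    rfl

/-- The map to the hom simplicial set given by a family. -/
def toMap (a : Fam P Y X) : P ⟶ sHom Y X where
  app n := ↾fun p =>
    { app := fun {m} φ => a.z (P.map φ.op p : P _⦋m⦌)
      d_comm := fun φ i => by
        rw [a.d_comm, op_comp, Functor.map_comp_apply]
        rfl
      dTop_comm := fun φ => by
        rw [a.dTop_comm, op_comp, Functor.map_comp_apply]
        rfl
      s_comm := fun φ i => by
        rw [a.s_comm, op_comp, Functor.map_comp_apply]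
        rfl }
  naturality n k θ := by
    ext p
    refine HomSimplex.ext ?_
    funext m φ
    change a.z (P.map φ.op (P.map θ p)) = a.z (P.map (φ ≫ θ.unop).op p)
    rw [op_comp, Functor.map_comp_apply]
    rfl

/-- Maps to the hom simplicial set are the same as families. -/
def mapEquiv : (P ⟶ sHom Y X) ≃ Fam P Y X where
  toFun := ofMap
  invFun := toMap
  left_inv g := by
    ext n p
    refine HomSimplex.ext ?_
    funext m φ
    exact value_map_app g φ p
  right_inv a := by
    ext m p
    change a.z (P.map (𝟙 (op ⦋m⦌)) p) = a.z p
    rw [Functor.map_id_apply]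

lemma isPower_iff {L : TSimplicialObject T} {κ : Q ⟶ (L ⟶[SSet.{v}] X)} :
    IsPower Q X L κ ↔ ∀ (Y : TSimplicialObject T) (P : SSet.{v}),
      Function.Bijective (fun a : Fam P Y L => a.comp (ofMap κ)) := by
  rw [_root_.isPower_iff]
  refine forall_congr' fun Y => forall_congr' fun P => ?_
  have h : (fun a : Fam P Y L => a.comp (ofMap κ)) ∘ mapEquiv =
      mapEquiv ∘ fun g : P ⟶ (Y ⟶[SSet.{v}] L) => cylinderComp κ Y g := rfl
  rw [← mapEquiv.bijective.of_comp_iff, h]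
  exact (mapEquiv.bijective.of_comp_iff' _).symm

/-- The constant family at a morphism. -/
def const (a : Y ⟶ X) (P : SSet.{v}) : Fam P Y X where
  z {m} _ := Hom.f a m
  d_comm _ i := Hom.d_comm a _ i
  dTop_comm _ := Hom.dTop_comm a _
  s_comm _ i := Hom.s_comm a _ i

/-- The morphism given by a family indexed by the terminal simplicial set. -/
def toHom (a : Fam (𝟙_ SSet.{v}) Y X) : Y ⟶ X where
  f n := a.z (m := n) PUnit.unit
  d_comm _ i := a.d_comm _ i
  dTop_comm _ := a.dTop_comm _
  s_comm _ i := a.s_comm _ i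

/-- The reindexing of a family. -/
def reindex (r : P ⟶ Q) (a : Fam Q Y X) : Fam P Y X where
  z {m} p := a.z (r.app (op ⦋m⦌) p)
  d_comm p i := by
    rw [a.d_comm]
    exact congrArg (fun q => _ ≫ a.z q) (NatTrans.naturality_apply r _ p).symm
  dTop_comm p := by
    rw [a.dTop_comm]
    exact congrArg (fun q => _ ≫ T.map (a.z q)) (NatTrans.naturality_apply r _ p).symm
  s_comm p i := by
    rw [a.s_comm]
    exact congrArg (fun q => _ ≫ a.z q) (NatTrans.naturality_apply r _ p).symm

end Fam

/-- The nerve condition is invariant under isomorphism. -/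
lemma IsTCategory.of_iso {X Y : TSimplicialObject T} (hX : X.IsTCategory) (a : X ⟶ Y) (b : Y ⟶ X)
    (hab : a ≫ b = 𝟙 X) (hba : b ≫ a = 𝟙 Y) : Y.IsTCategory := by
  let e (n : ℕ) : X.X n ≅ Y.X n :=
    { hom := Hom.f a n
      inv := Hom.f b n
      hom_inv_id := congrArg (fun c : X ⟶ X => Hom.f c n) hab
      inv_hom_id := congrArg (fun c : Y ⟶ Y => Hom.f c n) hba }
  intro n
  exact IsPullback.of_iso (hX n) (e (n + 2)) (T.mapIso (e (n + 1))) (e (n + 1)) (T.mapIso (e n))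
    (Hom.dTop_comm a (n + 1)).symm (Hom.d_comm a (n + 1) 0).symm
    (by
      change T.map _ ≫ T.map _ = T.map _ ≫ T.map _
      rw [← T.map_comp, ← T.map_comp]
      exact congrArg (fun f => T.map f) (Hom.d_comm a n 0).symm)
    (Hom.dTop_comm a n).symm

/-- Powers are unique up to isomorphism, so that one is a `T`-category if another one is. -/
lemma isTCategory_of_isPower {A : SSet.{v}} {L L' : TSimplicialObject T}
    {κ : A ⟶ (L ⟶[SSet.{v}] X)} {κ' : A ⟶ (L' ⟶[SSet.{v}] X)} (h : IsPower A X L κ)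
    (h' : IsPower A X L' κ') (hL : L.IsTCategory) : L'.IsTCategory := by
  rw [Fam.isPower_iff] at h h'
  -- The universal property at the terminal simplicial set: a cylinder on `M` is induced by a
  -- morphism to `N`. The injectivity half gives `ext`.
  have key {M N : TSimplicialObject T} (γ : Fam A M X) (δ : Fam A N X)
      (hN : ∀ (Y : TSimplicialObject T) (P : SSet.{v}),
        Function.Bijective (fun a : Fam P Y N => a.comp δ)) :
      ∃ a : M ⟶ N, ∀ (m : ℕ) (α : A _⦋m⦌), Hom.f a m ≫ δ.z α = γ.z α := by
    obtain ⟨a, ha⟩ := (hN M (𝟙_ SSet.{v})).2 (Fam.reindex (ρ_ A).hom γ)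
    exact ⟨a.toHom, fun m α => congrArg (fun f : Fam (A ⊗ 𝟙_ SSet.{v}) M X =>
      f.z (m := m) (α, PUnit.unit)) ha⟩
  have ext {M : TSimplicialObject T} (δ : Fam A M X)
      (hM : ∀ (Y : TSimplicialObject T) (P : SSet.{v}),
        Function.Bijective (fun a : Fam P Y M => a.comp δ)) (a : M ⟶ M)
      (ha : ∀ (m : ℕ) (α : A _⦋m⦌), Hom.f a m ≫ δ.z α = δ.z α) : a = 𝟙 M := by
    have e : Fam.const a (𝟙_ SSet.{v}) = Fam.const (𝟙 M) (𝟙_ SSet.{v}) := by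
      refine (hM M (𝟙_ SSet.{v})).1 ?_
      ext m p
      exact (ha m p.1).trans (Category.id_comp _).symm
    exact congrArg Fam.toHom e
  obtain ⟨a, ha⟩ := key (Fam.ofMap κ) (Fam.ofMap κ') h'
  obtain ⟨b, hb⟩ := key (Fam.ofMap κ') (Fam.ofMap κ) h
  refine hL.of_iso a b (ext _ h _ fun m α => ?_) (ext _ h' _ fun m α => ?_)
  · change (Hom.f a m ≫ Hom.f b m) ≫ _ = _
    rw [Category.assoc, hb, ha]
  · change (Hom.f b m ≫ Hom.f a m) ≫ _ = _
    rw [Category.assoc, ha, hb]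

variable [HasPullbacks E]

/-- The universal cylinder of the power of a `T`-category by the `1`-simplex. -/
noncomputable def powerCylinder (hX : X.IsTCategory) :
    (Δ[1] : SSet.{v}) ⟶ (power hX ⟶[SSet.{v}] X) :=
  Fam.mapEquiv.symm (Power.cylinder hX)

lemma isPower_power (hX : X.IsTCategory) :
    IsPower (Δ[1] : SSet.{v}) X (power hX) (powerCylinder hX) := by
  rw [Fam.isPower_iff]
  intro Y P
  have h : Fam.ofMap (powerCylinder hX) = Power.cylinder hX := Fam.mapEquiv.apply_symm_apply _
  rw [h]
  exact Power.comp_cylinder_bijective hX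

end TSimplicialObject

/-! ### Homs into a `T`-category as nerves -/

namespace TSimplicialObject

variable {E : Type u} [Category.{v} E] {T : Monad E} {X Y : TSimplicialObject T}

/-- A transformation between morphisms `F` and `G` of `T`-simplicial objects: a family `t` of
generalized `1`-simplices from `F` to `G` indexed by the `0`-simplices of `X`, such that both ways
around the naturality square of a `1`-simplex of `X` agree; their common value is `k`. -/
structure Transformation (F G : Hom X Y) where
  /-- the components -/
  t : X.X 0 ⟶ Y.X 1
  /-- the diagonals of the naturality squares -/
  k : X.X 1 ⟶ Y.X 1
  cod : t ≫ Y.d 0 0 = G.f 0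
  dom : t ≫ Y.dTop 0 = F.f 0 ≫ T.η.app _
  left : Y.IsComp (X.d 0 0 ≫ t) (F.f 1 ≫ T.η.app _) k
  right : Y.IsComp (G.f 1) (X.dTop 0 ≫ T.map t) k

namespace Transformation

lemma ext (hY : Y.IsTCategory) {F G : Hom X Y} {a b : Transformation F G} (h : a.t = b.t) :
    a = b := by
  obtain ⟨t, k, _, _, l, _⟩ := a
  obtain ⟨t', k', _, _, l', _⟩ := b
  obtain rfl : t = t' := h
  obtain rfl := l.unique hY l'
  rfl

lemma k_cod {F G : Hom X Y} (a : Transformation F G) :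
    a.k ≫ Y.d 0 0 = X.d 0 0 ≫ G.f 0 := by
  rw [a.left.cod, Category.assoc, a.cod]

lemma k_dom {F G : Hom X Y} (a : Transformation F G) :
    a.k ≫ Y.dTop 0 = X.dTop 0 ≫ T.map (F.f 0) := by
  rw [a.left.dom, Category.assoc, reassoc_of% η_naturality (Y.dTop 0), η_μ, Category.comp_id,
    F.dTop_comm]

/-- At a degenerate 1-simplex one side of the naturality square is an identity, so the diagonal is
`t`. Thus `k` alone determines a transformation. -/
lemma t_eq (hY : Y.IsTCategory) {F G : Hom X Y} (a : Transformation F G) :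
    a.t = X.s 0 0 ≫ a.k := by
  have h := a.left.precomp (X.s 0 0)
  rw [reassoc_of% X.s_zero_comp_d, ← reassoc_of% F.s_comm 0 0] at h
  have h' := IsComp.id_right a.t
  rw [reassoc_of% a.dom, η_naturality] at h'
  exact h'.unique hY h

/-- The identity transformation. -/
def id (F : Hom X Y) : Transformation F F where
  t := F.f 0 ≫ Y.s 0 0
  k := F.f 1
  cod := by rw [Category.assoc, s_zero_comp_d, Category.comp_id]
  dom := by rw [Category.assoc, s_zero_comp_dTop]
  left := by
    rw [← reassoc_of% F.d_comm 0 0]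
    exact IsComp.id_left _
  right := by
    rw [T.map_comp, ← reassoc_of% F.dTop_comm 0]
    exact IsComp.id_right _

section Comp

variable {F G H : Hom X Y} (a : Transformation F G) (b : Transformation G H)

/-- The new diagonal is `b` after the diagonal of `a`. Rebracketing with `a.left` gives one half of
naturality; the other passes through `b.left`, `a.right` and `b.right`. -/
lemma exists_comp (hY : Y.IsTCategory) :
    ∃ c : Transformation F H, Y.IsComp b.t (a.t ≫ T.η.app _) c.t ∧
      Y.IsComp (X.d 0 0 ≫ b.t) (a.k ≫ T.η.app _) c.k := by
  obtain ⟨t, ht⟩ := IsComp.exists_of (g := b.t) (f := a.t ≫ T.η.app _) hY (by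
    rw [b.dom, Category.assoc, η_naturality, reassoc_of% a.cod])
  obtain ⟨k, hk⟩ := IsComp.exists_of (g := X.d 0 0 ≫ b.t) (f := a.k ≫ T.η.app _) hY (by
    rw [Category.assoc, b.dom, Category.assoc, η_naturality, reassoc_of% a.k_cod])
  refine ⟨⟨t, k, ?_, ?_, ?_, ?_⟩, ht, hk⟩
  · rw [ht.cod, b.cod]
  · rw [ht.dom, Category.assoc, reassoc_of% η_naturality (Y.dTop 0), η_μ, Category.comp_id, a.dom]
  · have h := ht.precomp (X.d 0 0)
    rw [← Category.assoc (X.d 0 0) a.t] at h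
    exact (IsComp.assoc_unary hY h a.left).1 hk
  · exact (IsComp.assoc_map hY b.right ht).2 ((IsComp.assoc_unary hY b.left a.right).1 hk)

/-- The composite of two transformations. -/
noncomputable def comp (hY : Y.IsTCategory) : Transformation F H :=
  (exists_comp a b hY).choose

lemma comp_t (hY : Y.IsTCategory) : Y.IsComp b.t (a.t ≫ T.η.app _) (a.comp b hY).t :=
  (exists_comp a b hY).choose_spec.1

lemma comp_k (hY : Y.IsTCategory) :
    Y.IsComp (X.d 0 0 ≫ b.t) (a.k ≫ T.η.app _) (a.comp b hY).k :=
  (exists_comp a b hY).choose_spec.2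

/-- The value of a composite transformation at a composite. -/
lemma comp_isComp (hY : Y.IsTCategory) :
    Y.IsComp (X.d 1 0 ≫ b.k) (X.dTop 1 ≫ T.map a.k) (X.d 1 1 ≫ (a.comp b hY).k) := by
  have hG : Y.IsComp (X.d 1 0 ≫ G.f 1) (X.dTop 1 ≫ T.map (G.f 1)) (X.d 1 1 ≫ G.f 1) :=
    ⟨G.f 2, G.d_comm 1 0, G.dTop_comm 1, G.d_comm 1 1⟩
  -- Both bracketings of `G`, `G` and the components of `a`; the witness `r` of `a.right` supplies
  -- the family of pairs.
  have h₁ : Y.IsComp (X.d 1 0 ≫ G.f 1) (X.dTop 1 ≫ T.map a.k) (X.d 1 1 ≫ a.k) := by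
    obtain ⟨r, h₀, h₂, hr⟩ := a.right
    have h := IsComp.assoc_left (g := X.d 1 0 ≫ G.f 1) (b := X.dTop 1 ≫ T.map r)
      (ab := X.d 1 1 ≫ G.f 1) (k := X.d 1 1 ≫ a.k) hY
      (by rwa [Category.assoc, ← T.map_comp, h₀]) (by
        have := a.right.precomp (X.d 1 1)
        rwa [reassoc_of% d_one_one_comp_dTop, ← μ_naturality, ← T.map_comp_assoc, ← h₂,
          T.map_comp, Category.assoc, ← Category.assoc] at this)
    rwa [Category.assoc, ← T.map_comp, hr] at h
  have h₂ := b.left.precomp (X.d 1 0)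
  rw [← Category.assoc (X.d 1 0) (G.f 1)] at h₂
  refine (IsComp.assoc_unary hY h₂ h₁).1 ?_
  have := (a.comp_k b hY).precomp (X.d 1 1)
  rwa [← reassoc_of% d_one_zero_comp_d, ← Category.assoc (X.d 1 1) a.k] at this

end Comp

end Transformation

/-- The category of morphisms from `X` to a `T`-category `Y`, and their transformations. -/
def HomCat (X : TSimplicialObject T) {Y : TSimplicialObject T} (_ : Y.IsTCategory) : Type v :=
  Hom X Y

namespace HomCat

variable (hY : Y.IsTCategory)

noncomputable instance : SmallCategory (HomCat X hY) where
  Hom F G := Transformation (X := X) (Y := Y) F G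
  id F := Transformation.id F
  comp a b := a.comp b hY
  id_comp {F G} a := by
    refine Transformation.ext hY (((Transformation.id F).comp_t a hY).unique hY ?_)
    have h := IsComp.id_right a.t
    rwa [reassoc_of% a.dom, η_naturality, ← Category.assoc] at h
  comp_id {F G} a := by
    refine Transformation.ext hY ((a.comp_t (Transformation.id G) hY).unique hY ?_)
    have h := IsComp.id_left a.t
    rwa [reassoc_of% a.cod] at h
  assoc a b c := by
    refine Transformation.ext hY (((a.comp b hY).comp_t c hY).unique hY ?_)
    exact (IsComp.assoc_unary hY (b.comp_t c hY) (a.comp_t b hY)).2 (a.comp_t (b.comp c hY) hY)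

/-- The lowest levels of the universal family indexed by the nerve of the category of
transformations. -/
noncomputable def level : Fam.Level (nerve (HomCat X hY)) X Y 0 where
  a p := Hom.f (p.obj 0) 0
  b p := Transformation.k (ComposableArrows.hom p)
  d_zero p := Transformation.k_cod (ComposableArrows.hom p)
  dTop p := Transformation.k_dom (ComposableArrows.hom p)

/-- The universal family indexed by the nerve of the category of transformations. -/
noncomputable def fam : Fam (nerve (HomCat X hY)) X Y :=
  Fam.extend hY (level hY)
    (fun p => by
      have h : ComposableArrows.hom ((nerve (HomCat X hY)).σ 0 p) = 𝟙 (p.obj 0) := p.map_id 0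
      refine (Hom.s_comm (p.obj 0) 0 0).trans ?_
      exact congrArg (fun a : Transformation _ _ => X.s 0 0 ≫ a.k) h.symm)
    (fun (p : ComposableArrows (HomCat X hY) 2) => by
      have h := Transformation.comp_isComp (p.map' 0 1) (p.map' 1 2) hY
      have e : p.map' 0 2 = Transformation.comp (p.map' 0 1) (p.map' 1 2) hY :=
        ComposableArrows.map'_comp p 0 1 2
      rw [← e] at h
      exact h)

/-- The universal family, as a map to the hom simplicial set. -/
noncomputable def nerveToHom : nerve (HomCat X hY) ⟶ sHom X Y := (fam hY).toMap

include hY in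
lemma hom_ext_one {F G : Hom X Y} (h : F.f 1 = G.f 1) : F = G := by
  have e : Fam.const (show X ⟶ Y from F) (𝟙_ SSet.{v}) =
      Fam.const (show X ⟶ Y from G) (𝟙_ SSet.{v}) :=
    Fam.ext_one hY fun _ => h
  exact congrArg Fam.toHom e

lemma hom_hext {F G F' G' : HomCat X hY} (hF : F = F') (hG : G = G') (a : F ⟶ G) (b : F' ⟶ G')
    (h : Transformation.k a = Transformation.k b) : HEq a b := by
  subst hF hG
  exact heq_of_eq (Transformation.ext hY (((Transformation.t_eq hY a).trans
    (congrArg (fun k => X.s 0 0 ≫ k) h)).trans (Transformation.t_eq hY b).symm))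

/-- The component at an edge `i ≤ j` is the diagonal of the corresponding transformation. For `i =
j` this is level 1 of the vertex, which determines that morphism. -/
lemma nerveToHom_injective (n : ℕ) :
    Function.Injective ((nerveToHom (X := X) hY).app (op ⦋n⦌)) := by
  intro (p : ComposableArrows (HomCat X hY) n) (q : ComposableArrows (HomCat X hY) n) h
  have hk {i j : Fin (n + 1)} (hij : i ≤ j) :
      Transformation.k (p.map (homOfLE hij)) = Transformation.k (q.map (homOfLE hij)) :=
    congrArg (fun x : HomSimplex X Y ⦋n⦌ => x.app (SimplexCategory.mkOfLe i j hij)) h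
  have ho (i : Fin (n + 1)) : p.obj i = q.obj i := by
    have h := hk (le_refl i)
    have hp : p.map (homOfLE (le_refl i)) = 𝟙 (p.obj i) := p.map_id i
    have hq : q.map (homOfLE (le_refl i)) = 𝟙 (q.obj i) := q.map_id i
    rw [hp, hq] at h
    exact hom_ext_one hY h
  exact CategoryTheory.Functor.hext ho fun i j f =>
    hom_hext hY (ho i) (ho j) _ _ (hk (leOfHom f))

section Surjective

variable {n : ℕ} (x : HomSimplex X Y ⦋n⦌)

/-- The family given by a simplex of the hom simplicial set. -/
def simplexFam : Fam (yoneda.obj ⦋n⦌) X Y where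
  z {m} φ := x.app (show ⦋m⦌ ⟶ ⦋n⦌ from φ)
  d_comm _ i := x.d_comm _ i
  dTop_comm _ := x.dTop_comm _
  s_comm _ i := x.s_comm _ i

include hY in
lemma simplex_ext_one {x y : HomSimplex X Y ⦋n⦌}
    (h : ∀ φ : ⦋1⦌ ⟶ ⦋n⦌, x.app φ = y.app φ) : x = y := by
  have e : simplexFam x = simplexFam y := Fam.ext_one hY h
  refine HomSimplex.ext ?_
  funext m φ
  exact congrArg (fun a : Fam (yoneda.obj ⦋n⦌) X Y => a.z (m := m) φ) e

/-- The vertices of a simplex of the hom simplicial set. -/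
def vertex (i : Fin (n + 1)) : Hom X Y where
  f m := x.app (SimplexCategory.const ⦋m⦌ ⦋n⦌ i)
  d_comm _ j := x.d_comm _ j
  dTop_comm _ := x.dTop_comm _
  s_comm _ j := x.s_comm _ j

/-- The edges of a simplex of the hom simplicial set. -/
def edge {i j : Fin (n + 1)} (hij : i ≤ j) : Transformation (vertex x i) (vertex x j) where
  t := X.s 0 0 ≫ x.app (SimplexCategory.mkOfLe i j hij)
  k := x.app (SimplexCategory.mkOfLe i j hij)
  cod := by
    rw [Category.assoc, x.d_comm, ← Category.assoc, s_zero_comp_d, Category.id_comp]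
    refine congrArg x.app ?_
    ext a
    fin_cases a
    rfl
  dom := by
    rw [Category.assoc, x.dTop_comm, ← Category.assoc, s_zero_comp_dTop, η_naturality]
    refine congrArg (fun φ => x.app φ ≫ T.η.app _) ?_
    ext a
    fin_cases a
    rfl
  left := by
    -- The two triangles are those of a prism: `i, i, j` on `s_1` here, and `i, j, j` on `s_0` for
    -- `right`.
    refine ⟨X.s 1 1 ≫ x.app (SimplexCategory.σ 0 ≫ SimplexCategory.mkOfLe i j hij), ?_, ?_, ?_⟩
    · have h : X.s 1 1 ≫ X.d 1 0 = X.d 0 0 ≫ X.s 0 0 := X.s_comp_d_of_lt 0 0 0 le_rfl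
      rw [Category.assoc, x.d_comm, reassoc_of% h]
      refine congrArg (fun φ => X.d 0 0 ≫ X.s 0 0 ≫ x.app φ) ?_
      ext a
      fin_cases a <;> rfl
    · have h : X.s 1 1 ≫ X.dTop 1 = T.η.app _ := X.s_last_comp_dTop 1
      rw [Category.assoc, x.dTop_comm, reassoc_of% h, η_naturality]
      refine congrArg (fun φ => x.app φ ≫ T.η.app _) ?_
      ext a
      fin_cases a <;> rfl
    · rw [Category.assoc, x.d_comm, ← Category.assoc, X.s_comp_d_self 1 1, Category.id_comp]
      refine congrArg x.app ?_
      ext a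
      fin_cases a <;> rfl
  right := by
    refine ⟨X.s 1 0 ≫ x.app (SimplexCategory.σ 1 ≫ SimplexCategory.mkOfLe i j hij), ?_, ?_, ?_⟩
    · rw [Category.assoc, x.d_comm, ← Category.assoc, X.s_comp_d_self 1 0, Category.id_comp]
      refine congrArg x.app ?_
      ext a
      fin_cases a <;> rfl
    · have h : X.s 1 0 ≫ X.dTop 1 = X.dTop 0 ≫ T.map (X.s 0 0) := X.s_comp_dTop 0 0
      rw [Category.assoc, x.dTop_comm, reassoc_of% h, ← T.map_comp]
      refine congrArg (fun φ => X.dTop 0 ≫ T.map (X.s 0 0 ≫ x.app φ)) ?_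
      ext a
      fin_cases a <;> rfl
    · have h : X.s 1 0 ≫ X.d 1 1 = 𝟙 _ := X.s_comp_d_succ 1 0
      rw [Category.assoc, x.d_comm, ← Category.assoc, h, Category.id_comp]
      refine congrArg x.app ?_
      ext a
      fin_cases a <;> rfl

/-- The functor given by a simplex of the hom simplicial set. -/
def edges : ComposableArrows (HomCat X hY) n where
  obj i := vertex x i
  map f := edge x (leOfHom f)
  map_id i := Transformation.ext hY <| by
    refine (congrArg (fun φ => X.s 0 0 ≫ x.app φ)
      (?_ : SimplexCategory.mkOfLe i i le_rfl =
        SimplexCategory.σ 0 ≫ SimplexCategory.const ⦋0⦌ ⦋n⦌ i)).trans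
      (x.s_comm (SimplexCategory.const ⦋0⦌ ⦋n⦌ i) 0).symm
    ext a
    fin_cases a <;> rfl
  map_comp {i j l} f g := Transformation.ext hY <| by
    refine IsComp.unique hY ?_ (Transformation.comp_t _ _ hY)
    let φ : ⦋2⦌ ⟶ ⦋n⦌ := SimplexCategory.mkOfLeComp i j l (leOfHom f) (leOfHom g)
    refine ⟨X.s 0 0 ≫ X.s 1 1 ≫ x.app φ, ?_, ?_, ?_⟩
    · have h : X.s 1 1 ≫ X.d 1 0 = X.d 0 0 ≫ X.s 0 0 := X.s_comp_d_of_lt 0 0 0 le_rfl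
      rw [Category.assoc, Category.assoc, x.d_comm, reassoc_of% h, reassoc_of% X.s_zero_comp_d]
      refine congrArg (fun φ => X.s 0 0 ≫ x.app φ) ?_
      ext a
      fin_cases a <;> rfl
    · have h : X.s 1 1 ≫ X.dTop 1 = T.η.app _ := X.s_last_comp_dTop 1
      rw [Category.assoc, Category.assoc, x.dTop_comm, reassoc_of% h, η_naturality]
      refine (congrArg (fun φ => X.s 0 0 ≫ x.app φ ≫ T.η.app _) ?_).trans
        (Category.assoc _ _ _).symm
      ext a
      fin_cases a <;> rfl
    · rw [Category.assoc, Category.assoc, x.d_comm, reassoc_of% X.s_comp_d_self 1 1]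
      refine congrArg (fun φ => X.s 0 0 ≫ x.app φ) ?_
      ext a
      fin_cases a <;> rfl

lemma nerveToHom_surjective : Function.Surjective ((nerveToHom (X := X) hY).app (op ⦋n⦌)) := by
  intro (x : HomSimplex X Y ⦋n⦌)
  refine ⟨edges hY x, simplex_ext_one hY fun φ => congrArg x.app ?_⟩
  ext a
  fin_cases a <;> rfl

end Surjective

end HomCat

/-- The hom simplicial set from a `T`-simplicial object to a `T`-category is a nerve. -/
lemma isIso_unit (hY : Y.IsTCategory) : IsIso (nerveAdjunction.unit.app (sHom X Y)) := by
  have : IsIso (HomCat.nerveToHom (X := X) hY) := by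
    rw [NatTrans.isIso_iff_isIso_app]
    intro ⟨n⟩
    induction n using SimplexCategory.rec with | _ n
    rw [isIso_iff_bijective]
    exact ⟨HomCat.nerveToHom_injective hY n, HomCat.nerveToHom_surjective hY⟩
  let e : nerve (HomCat X hY) ≅ sHom X Y := asIso (HomCat.nerveToHom hY)
  -- The nerve functor is fully faithful, so the unit is invertible on its essential image.
  exact Functor.essImage.unit_isIso ⟨Cat.of (HomCat X hY), ⟨e⟩⟩

end TSimplicialObject

/-! ### Powers under a change of enrichment -/

section Transport

variable {V : Type w} [Category.{w'} V] [MonoidalCategory V] [BraidedCategory V]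
  {C : Type u} [EnrichedCategory V C]

lemma cylinderComp_comp {A A' : V} {X L : C} (θ : A' ⟶ A) (κ : A ⟶ (L ⟶[V] X)) (Y : C) {W W' : V}
    (r : W' ⟶ W) (g : W ⟶ (Y ⟶[V] L)) :
    cylinderComp (θ ≫ κ) Y (r ≫ g) = (θ ⊗ₘ r) ≫ cylinderComp κ Y g := by
  simp [cylinderComp, tensorHom_def', whisker_exchange_assoc]

open Functor.LaxMonoidal

variable {W : Type*} [Category* W] [MonoidalCategory W] [BraidedCategory W] (F : V ⥤ W) [F.Braided]

lemma cylinderComp_map {A P : V} {X L : C} (κ : A ⟶ (L ⟶[V] X)) (Y : C) (g : P ⟶ (Y ⟶[V] L)) :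
    cylinderComp (C := TransportEnrichment F C) (X := X) (L := L) (F.map κ) Y (F.map g) =
      μ F A P ≫ F.map (cylinderComp κ Y g) := by
  change F.obj A ◁ F.map g ≫ (β_ _ _).hom ≫ F.obj (Y ⟶[V] L) ◁ F.map κ ≫
    μ F _ _ ≫ F.map (eComp V Y L X) = _
  rw [μ_natural_right_assoc, ← Functor.LaxBraided.braided_assoc, μ_natural_right_assoc,
    cylinderComp, F.map_comp, F.map_comp, F.map_comp]

/-- Powers are preserved by a change of enrichment along a braided monoidal functor which has enough
objects in its image, and for which the hom objects are local. -/
lemma IsPower.transport [MonoidalClosed V] [MonoidalClosed W]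
    (hlocal : ∀ (X Y : C) (P : V),
      Function.Bijective (fun g : P ⟶ (X ⟶[V] Y) => F.map g))
    (hF : ∀ U : W, ∃ P : V, Nonempty (U ≅ F.obj P))
    {A : V} {A' : W} (θ : A' ≅ F.obj A) {X L : C} {κ : A ⟶ (L ⟶[V] X)} (h : IsPower A X L κ) :
    IsPower (C := TransportEnrichment F C) A' X L (θ.hom ≫ F.map κ) := by
  rw [isPower_iff] at h
  refine isPower_iff.2 fun Y U => ?_
  obtain ⟨P, ⟨e⟩⟩ := hF U
  let Y' : C := Y
  -- Writing `U` as `F.obj P`, locality identifies maps out of `U` with maps out of `P`; as `F` is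
  -- monoidal, the same holds for `A' ⊗ U` and `A ⊗ P`.
  let a : (P ⟶ (Y' ⟶[V] L)) → (U ⟶ F.obj (Y' ⟶[V] L)) := fun g => e.hom ≫ F.map g
  have ha : Function.Bijective a :=
    (e.symm.homFromEquiv (Z := F.obj (Y' ⟶[V] L))).bijective.comp (hlocal Y' L P)
  let b : (A ⊗ P ⟶ (Y' ⟶[V] X)) → (A' ⊗ U ⟶ F.obj (Y' ⟶[V] X)) := fun k =>
    (θ.hom ⊗ₘ e.hom) ≫ μ F A P ≫ F.map k
  have hb : Function.Bijective b := by
    convert (((θ ⊗ᵢ e) ≪≫ Functor.Monoidal.μIso F A P).symm.homFromEquiv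
      (Z := F.obj (Y' ⟶[V] X))).bijective.comp (hlocal Y' X (A ⊗ P)) using 1
    funext k
    simp [b, Iso.homFromEquiv]
  have hab (g : P ⟶ (Y' ⟶[V] L)) : cylinderComp (C := TransportEnrichment F C) (X := X) (L := L)
      (θ.hom ≫ F.map κ) Y (a g) = b (cylinderComp κ Y' g) := by
    refine (cylinderComp_comp (C := TransportEnrichment F C) (X := X) (L := L)
      θ.hom (F.map κ) Y e.hom (F.map g)).trans ?_
    exact congrArg (fun k => (θ.hom ⊗ₘ e.hom) ≫ k) (cylinderComp_map F κ Y' g)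
  refine (Function.Bijective.of_comp_iff _ ha).1 ?_
  exact (congrArg Function.Bijective (funext hab)).mpr (hb.comp (h Y' P))

end Transport

/-- Under the adjunction, applying `F` to a map into `S` becomes composition with the unit at `S`.
-/
lemma bijective_map_of_isIso_unit {C : Type*} [Category* C] {D : Type*} [Category* D] {F : C ⥤ D}
    {G : D ⥤ C} (adj : F ⊣ G) (S : C) [IsIso (adj.unit.app S)] (P : C) :
    Function.Bijective (fun g : P ⟶ S => F.map g) := by
  rw [← (adj.homEquiv P (F.obj S)).bijective.of_comp_iff']
  have h : adj.homEquiv P (F.obj S) ∘ (fun g : P ⟶ S => F.map g) =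
      (asIso (adj.unit.app S)).homToEquiv (Z := P) := by
    funext g
    simp [Adjunction.homEquiv_unit, Iso.homToEquiv]
  rw [h]
  exact Equiv.bijective _

/-! ### Powers by the arrow category -/

namespace TSimplicialObject

/-- The homotopy category functor is braided for the cartesian monoidal structures. -/
@[reducible]
noncomputable def hoFunctorBraided : SSet.hoFunctor.{v}.Braided where
  braided X Y := by
    rw [← cancel_mono (Functor.Monoidal.μIso _ _ _).inv]
    ext <;> simp [← Functor.map_comp]

/-- The two small models of the arrow category are isomorphic. -/
def asSmallIso : Cat.of (AsSmall.{v} (Fin 2)) ≅ Cat.of (ULift.{v} (Fin 2)) where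
  hom := Functor.toCatHom
    { obj := fun i => ⟨ULift.down i⟩
      map := fun {i j} f => homOfLE
        (show (ULift.down i : Fin 2) ≤ ULift.down j from leOfHom f.down) }
  inv := Functor.toCatHom
    { obj := fun i => ⟨i.down⟩
      map := fun {i j} f => ⟨homOfLE
        (show i ≤ j from leOfHom (show (i : ULift.{v} (Fin 2)) ⟶ j from f))⟩ }

/-- The arrow category is the homotopy category of the `1`-simplex. -/
noncomputable def arrowIso : Cat.of (AsSmall.{v} (Fin 2)) ≅ SSet.hoFunctor.{v}.obj Δ[1] :=
  asSmallIso ≪≫ (nerveFunctorCompHoFunctorIso.app (Cat.of (ULift.{v} (Fin 2)))).symm ≪≫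
    SSet.hoFunctor.mapIso (SSet.stdSimplex.isoNerve 1).symm

variable {E : Type u} [Category.{v} E] {T : Monad E} [HasPullbacks E]

attribute [local instance] hoFunctorBraided in
/-- The `2`-category of `T`-categories has powers by the arrow category. -/
lemma exists_isPower_arrow (X : TCat T) :
    ∃ (L : TCat T) (κ : Cat.of (AsSmall.{v} (Fin 2)) ⟶ (L ⟶[Cat.{v, v}] X)),
      IsPower (Cat.of (AsSmall.{v} (Fin 2))) X L κ := by
  let L : TCat T := ⟨power X.property, power_isTCategory X.property⟩
  -- The subcategory has the same hom objects and contains `L`, so the power restricts to it.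
  have h : IsPower (C := TCat T) (Δ[1] : SSet.{v}) X L (powerCylinder X.property) :=
    fun Y => isPower_power X.property Y.obj
  refine ⟨L, _, h.transport SSet.hoFunctor.{v} (fun Y Z P => ?_) (fun U => ?_) arrowIso⟩
  · have := isIso_unit (X := Y.obj) Z.property
    exact bijective_map_of_isIso_unit nerveAdjunction _ P
  · exact ⟨nerveFunctor.obj U, ⟨(nerveFunctorCompHoFunctorIso.app U).symm⟩⟩

end TSimplicialObject

theorem theorem6p11 {E : Type u} [Category.{v} E] [HasPullbacks E] (T : Monad E) :
    (∀ X : TSimplicialObject T, X.IsTCategory →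
      (∃ (L : TSimplicialObject T) (κ : (Δ[1] : SSet.{v}) ⟶ (L ⟶[SSet.{v}] X)),
        IsPower (Δ[1] : SSet.{v}) X L κ) ∧
      (∀ (L : TSimplicialObject T) (κ : (Δ[1] : SSet.{v}) ⟶ (L ⟶[SSet.{v}] X)),
        IsPower (Δ[1] : SSet.{v}) X L κ → L.IsTCategory)) ∧
    (∀ X Y : TSimplicialObject T, Y.IsTCategory →
      IsIso (nerveAdjunction.unit.app (X ⟶[SSet.{v}] Y))) ∧
    (∀ X : TCat T, ∃ (L : TCat T) (κ : Cat.of (AsSmall.{v} (Fin 2)) ⟶ (L ⟶[Cat.{v, v}] X)),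
      IsPower (Cat.of (AsSmall.{v} (Fin 2))) X L κ) :=
  ⟨fun _ hX => ⟨⟨_, _, TSimplicialObject.isPower_power hX⟩,
      fun _ _ h => TSimplicialObject.isTCategory_of_isPower (TSimplicialObject.isPower_power hX) h
        (TSimplicialObject.power_isTCategory hX)⟩,
    fun _ _ hY => TSimplicialObject.isIso_unit hY, TSimplicialObject.exists_isPower_arrow⟩
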